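/- Let $M$ and $N$ be smooth manifolds modelled on Banach spaces $\mathbb E$ and $\mathbb E'$. A linear connection on $M$ is a connection map $K_M: TTM\to TM$ covering the projection $TM\to M$ which in every chart $(U_\alpha,\phi_\alpha)$ has the form $(x,\xi;y,\eta)\mapsto (x,\eta+\Gamma_\alpha(x)(\xi,y))$ with a smooth map $\Gamma_\alpha:\phi_\alpha(U_\alpha)\to \mathcal L(\mathbb E,\mathcal L(\mathbb E,\mathbb E))$. Let $g:M\to N$ be smooth and let $K_M,K_N$ be $g$-related linear connections on $M$ and $N$, i.e. $K_N\circ TTg=Tg\circ K_M$. For $k\in\mathbb N$ let $T^kM$ be the set of classes $[\gamma,x]_k$ of smooth curves $\gamma:(-\epsilon,\epsilon)\to M$, $\gamma(0)=x$, where two curves are identified if their derivatives at $0$ agree up to order $k$; it is topologized by the charts $[\gamma,x]_k\mapsto\big((\phi_\alpha\circ\gamma)(0),(\phi_\alpha\circ\gamma)'(0),\dots,\tfrac1{k!}(\phi_\alpha\circ\gamma)^{(k)}(0)\big)$. Put $T^kg([\gamma,x]_k)=[g\circ\gamma,g(x)]_k$, let $T^\infty M=\varprojlim T^kM$ along the maps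 $[\gamma,x]_j\mapsto[\gamma,x]_i$ ($i\le j$), with the limit topology and the projection $\pi^\infty_M:T^\infty M\to M$, and let $T^\infty g=\varprojlim T^kg$. Put $M^0_\alpha=\mathrm{id}$, $M^1_\alpha(x,\xi_1)y=\Gamma_\alpha(x)(\xi_1,y)$ and $$M^{k}_\alpha(x,\xi_1,\dots,\xi_{k})y=\tfrac1k\Big(\sum_{i=1}^{k}\partial_iM^{k-1}_\alpha(x,\xi_1,\dots,\xi_{k-1})(y,i\xi_i)+M^1_\alpha(x,\xi_1)\big[M^{k-1}_\alpha(x,\xi_1,\dots,\xi_{k-1})y\big]\Big),$$ where $\partial_i$ is the partial derivative with respect to the $i$-th of the variables $x,\xi_1,\dots,\xi_{k-1}$. With $\gamma_\alpha=\phi_\alpha\circ\gamma$ and $\xi_i=\gamma_\alpha^{(i)}(0)/i!$ let $$z^m_\alpha=\tfrac1m\sum_{j=0}^{m-1}M^j_\alpha(\gamma_\alpha(0),\xi_1,\dots,\xi_j)\,\frac{\gamma_\alpha^{(m-j)}(0)}{(m-j-1)!},$$ and let $\Phi^\infty_\alpha=\varprojlim\Phi^k_\alpha$, where $\Phi^k_\alpha([\gamma,x]_k)=(\phi_\alpha(x),z^1_\alpha,\dots,z^k_\alpha)$.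 Define $\Psi^k_\beta$ and $\Psi^\infty_\beta$ in the same way from the charts $(V_\beta,\psi_\beta)$ of $N$ and $K_N$. Let $\mathbb F=\varprojlim\mathbb E^k$, $\mathbb F'=\varprojlim\mathbb E'^k$. Let $\mathcal H(\mathbb F,\mathbb F')$ be the Fréchet space of sequences $(l_k)_k\in\prod_k\mathcal L(\mathbb E^k,\mathbb E'^k)$ that commute with the projections to the first factors; it is the limit of the Banach spaces $\mathcal H^k(\mathbb E^k,\mathbb E'^k)$ of finite such systems $(l_i)_{i\le k}$. Let $\varepsilon:\mathcal H(\mathbb F,\mathbb F')\to\mathcal L(\mathbb F,\mathbb F')$, $(l_k)_k\mapsto\varprojlim l_k$. A map from an open subset of $\mathbb E$ into $\mathcal H(\mathbb F,\mathbb F')$ is called generalized smooth (in the sense of Leslie and Galanis) if all its factors, with values in the $\mathcal H^k(\mathbb E^k,\mathbb E'^k)$, are smooth. **Theorem.** (1) $(T^\infty M,\pi^\infty_M,M)$ and $(T^\infty N,\pi^\infty_N,N)$, with the trivializations $\Phi^\infty_\alpha$ and $\Psi^\infty_\beta$, are generalized vector bundles with fibre types $\mathbb F$ and $\mathbb F'$: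 for each $\alpha$ the map $\Phi_\alpha^\infty:(\pi^\infty_M)^{-1}(U_\alpha)\to\phi_\alpha(U_\alpha)\times\mathbb F$ is a homeomorphism over $\phi_\alpha$, and the transition maps between any two of these trivializations have the form $\varepsilon\circ h$ on the fibres with $h:\phi_\alpha(U_\alpha\cap U_{\alpha'})\to\mathcal H(\mathbb F,\mathbb F)$ generalized smooth; likewise for $N$. (2) $(T^\infty g,g):(T^\infty M,\pi_M^\infty,M)\to(T^\infty N,\pi_N^\infty,N)$ is a generalized vector bundle morphism: $T^\infty g$ is continuous, $\pi^\infty_N\circ T^\infty g=g\circ\pi^\infty_M$, and for all $\alpha,\beta$ there is a generalized smooth map $h:\phi_\alpha(U_\alpha\cap g^{-1}(V_\beta))\to\mathcal H(\mathbb F,\mathbb F')$ such that $\Psi^\infty_{\beta,g(x)}\circ T^\infty_xg\circ(\Phi^\infty_{\alpha,x})^{-1}=\varepsilon(h(\phi_\alpha(x)))$ for all $x\in U_\alpha\cap g^{-1}(V_\beta)$. (3) If $g$ is a diffeomorphism, then $(T^\infty g,g)$ is an isomorphism of generalized vector bundles, i.e. it has an inverse which is again a generalized vector bundle morphism. -/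

import Mathlib

open Set Topology
open scoped Manifold ContDiff

noncomputable section

/-! ## Linear connections as connection maps `TTM → TM` -/

section Connections

variable {E M : Type*} [NormedAddCommGroup E] [NormedSpace ℝ E]
  [TopologicalSpace M] [ChartedSpace E M] [IsManifold 𝓘(ℝ, E) ∞ M]

variable (E M) in
/-- The double tangent bundle `TTM` of a manifold `M` modelled on `E`. -/
abbrev DoubleTangent : Type _ :=
  TangentBundle 𝓘(ℝ, E).tangent (TangentBundle 𝓘(ℝ, E) M)

/-- The coordinates `(x, y) ∈ E × E` of a tangent vector of `M` in the chart `e`: `(x; y) = Te(v)`. -/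
def tangentCoord (e : atlas E M) (v : TangentBundle 𝓘(ℝ, E) M) : E × E :=
  Bundle.TotalSpace.toProd E E (tangentMap 𝓘(ℝ, E) 𝓘(ℝ, E) (e : M → E) v)

/-- The coordinates `((x, ξ), (y, η))` of an element of `TTM` in the chart `e`, namely
`(x, ξ; y, η) = TTe(w)`. -/
def doubleTangentCoord (e : atlas E M) (w : DoubleTangent E M) : (E × E) × (E × E) :=
  let w' := tangentMap 𝓘(ℝ, E).tangent 𝓘(ℝ, E).tangent
    (tangentMap 𝓘(ℝ, E) 𝓘(ℝ, E) (e : M → E)) w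
  (Bundle.TotalSpace.toProd E E w'.proj, w'.snd)

variable (E M) in
/-- A smooth linear connection on `M`, given by its connection map `K : TTM → TM` together with its
Christoffel symbols: `K` covers the projection `TM → M` and in each chart of the atlas it reads
`K(x, ξ; y, η) = (x, η + Γ(x)(ξ, y))`. (On the domain of a chart the symbols are determined
by `K`; elsewhere the values of `christoffel` are irrelevant.) -/
structure LinearConnection where
  toFun : DoubleTangent E M → TangentBundle 𝓘(ℝ, E) M
  christoffel : atlas E M → E → E →L[ℝ] E →L[ℝ] E
  proj_toFun : ∀ w, (toFun w).proj = w.proj.proj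
  contDiffOn_christoffel : ∀ e : atlas E M, ContDiffOn ℝ ∞ (christoffel e) e.1.target
  local_form : ∀ (e : atlas E M) (w : DoubleTangent E M), w.proj.proj ∈ e.1.source →
    ∀ x ξ y η : E, doubleTangentCoord e w = ((x, ξ), (y, η)) →
      tangentCoord e (toFun w) = (x, η + christoffel e x ξ y)

/-- Two linear connections are `g`-related if `K_N ∘ TTg = Tg ∘ K_M`. -/
def LinearConnection.Related {E' N : Type*} [NormedAddCommGroup E'] [NormedSpace ℝ E']
    [TopologicalSpace N] [ChartedSpace E' N] [IsManifold 𝓘(ℝ, E') ∞ N]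
    (KM : LinearConnection E M) (KN : LinearConnection E' N) (g : M → N) : Prop :=
  ∀ w : DoubleTangent E M,
    KN.toFun (tangentMap 𝓘(ℝ, E).tangent 𝓘(ℝ, E').tangent
        (tangentMap 𝓘(ℝ, E) 𝓘(ℝ, E') g) w) =
      tangentMap 𝓘(ℝ, E) 𝓘(ℝ, E') g (KM.toFun w)

/-- The local components of the connection maps on `T^kM` induced by a linear connection with
Christoffel symbols `Γ`. The argument `u = (x, ξ₁, …, ξ_k)` is indexed by `Fin (k + 1)`;
`M⁰ = id` and
`M^{k+1}(u) y = (∑_{i=1}^{k+1} ∂ᵢM^k(x, ξ₁, …, ξ_k)(y, i ξᵢ) + Γ(x)(ξ₁, M^k(x, ξ₁, …, ξ_k) y)) / (k+1)`,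
so that `M¹(x, ξ₁) y = Γ(x)(ξ₁, y)`. Here `∂ᵢ` is the partial derivative in the `i`-th of the
variables `x, ξ₁, …, ξ_k`, and the sum is the total derivative in the direction
`(ξ₁, 2 ξ₂, …, (k+1) ξ_{k+1})`. -/
def connectionCoeff {E : Type*} [NormedAddCommGroup E] [NormedSpace ℝ E]
    (Γ : E → E →L[ℝ] E →L[ℝ] E) : (k : ℕ) → (Fin (k + 1) → E) → E →L[ℝ] E
  | 0, _ => ContinuousLinearMap.id ℝ E
  | k + 1, u => ((k : ℝ) + 1)⁻¹ •
      (fderiv ℝ (connectionCoeff Γ k) (Fin.init u) (fun i => ((i : ℝ) + 1) • u i.succ) +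
        (Γ (u 0) (u 1)).comp (connectionCoeff Γ k (Fin.init u)))

theorem connectionCoeff_one {E : Type*} [NormedAddCommGroup E] [NormedSpace ℝ E]
    (Γ : E → E →L[ℝ] E →L[ℝ] E) (u : Fin 2 → E) : connectionCoeff Γ 1 u = Γ (u 0) (u 1) := by
  simp [connectionCoeff]

/-- For a curve with Taylor coefficients `ξᵢ = γ⁽ⁱ⁾(0)/i!`, the coordinate
`z^m = (1/m) ∑_{j=0}^{m-1} M^j(ξ₀, …, ξⱼ) (γ⁽ᵐ⁻ʲ⁾(0)/(m-j-1)!)`. -/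
def zCoord {E : Type*} [NormedAddCommGroup E] [NormedSpace ℝ E]
    (Γ : E → E →L[ℝ] E →L[ℝ] E) (ξ : ℕ → E) (m : ℕ) : E :=
  (m : ℝ)⁻¹ • ∑ j ∈ Finset.range m,
    connectionCoeff Γ j (fun i => ξ i) (((m : ℝ) - j) • ξ (m - j))

end Connections

/-! ## Higher order tangent bundles -/

section OsculatingBundles

variable (E M : Type*) [NormedAddCommGroup E] [NormedSpace ℝ E]
  [TopologicalSpace M] [ChartedSpace E M]

/-- Curves in `M` that are smooth on some interval `(-ε, ε)` (the values elsewhere play no role). -/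
structure CurveGerm where
  toFun : ℝ → M
  smooth : ∃ ε > 0, ContMDiffOn 𝓘(ℝ, ℝ) 𝓘(ℝ, E) ∞ toFun (Ioo (-ε) ε)

/-- `γ₁ ≈ γ₂` if the curves have the same base point and their derivatives at `0` agree up to
order `k`, in the charts of the atlas. -/
def curveSetoid (k : ℕ) : Setoid (CurveGerm E M) where
  r γ₁ γ₂ := γ₁.toFun 0 = γ₂.toFun 0 ∧ ∀ e : atlas E M, γ₁.toFun 0 ∈ e.1.source →
    ∀ j ≤ k, iteratedDeriv j (e.1 ∘ γ₁.toFun) 0 = iteratedDeriv j (e.1 ∘ γ₂.toFun) 0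
  iseqv :=
    { refl := fun _ => ⟨rfl, fun _ _ _ _ => rfl⟩
      symm := fun h => ⟨h.1.symm, fun e he j hj => (h.2 e (h.1 ▸ he) j hj).symm⟩
      trans := fun h h' => ⟨h.1.trans h'.1, fun e he j hj =>
        (h.2 e he j hj).trans (h'.2 e (h.1 ▸ he) j hj)⟩ }

/-- The tangent bundle `T^kM` of order `k` (with `T⁰M = M`). -/
def OscBundle (k : ℕ) : Type _ := Quotient (curveSetoid E M k)

variable {E M}

namespace OscBundle

/-- The projection `π^k : T^kM → M`. -/
def proj {k : ℕ} : OscBundle E M k → M :=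
  Quotient.lift (fun γ => γ.toFun 0) (fun _ _ h => h.1)

/-- The connecting maps `π^{j,i} : T^jM → T^iM`, `i ≤ j`. -/
def res {i j : ℕ} (hij : i ≤ j) : OscBundle E M j → OscBundle E M i :=
  Quotient.map id (fun _ _ h => ⟨h.1, fun e he l hl => h.2 e he l (hl.trans hij)⟩)

open Classical in
/-- The Taylor coefficients `(e ∘ γ)⁽ⁱ⁾(0)/i!`, `0 ≤ i ≤ k`, of `[γ, x]_k` in a chart `e` around `x`
(extended by `0`). -/
def coord {k : ℕ} (e : atlas E M) : OscBundle E M k → ℕ → E :=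
  Quotient.lift
    (fun γ i => if γ.toFun 0 ∈ e.1.source ∧ i ≤ k then
      ((i.factorial : ℝ))⁻¹ • iteratedDeriv i (e.1 ∘ γ.toFun) 0 else 0)
    (by
      rintro γ₁ γ₂ ⟨h0, h⟩
      funext i
      by_cases hc : γ₁.toFun 0 ∈ e.1.source ∧ i ≤ k
      · have hc' : γ₂.toFun 0 ∈ e.1.source ∧ i ≤ k := h0 ▸ hc
        simp only [if_pos hc, if_pos hc', h e hc.1 i hc.2]
      · have hc' : ¬ (γ₂.toFun 0 ∈ e.1.source ∧ i ≤ k) := h0 ▸ hc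
        simp only [if_neg hc, if_neg hc'])

open Classical in
theorem coord_res {i j : ℕ} (hij : i ≤ j) (e : atlas E M) (u : OscBundle E M j) {l : ℕ}
    (hl : l ≤ i) : coord e (res hij u) l = coord e u l := by
  induction u using Quotient.inductionOn with
  | h γ =>
    change (if γ.toFun 0 ∈ e.1.source ∧ l ≤ i then
        ((l.factorial : ℝ))⁻¹ • iteratedDeriv l (e.1 ∘ γ.toFun) 0 else 0) =
      (if γ.toFun 0 ∈ e.1.source ∧ l ≤ j then
        ((l.factorial : ℝ))⁻¹ • iteratedDeriv l (e.1 ∘ γ.toFun) 0 else 0)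
    simp only [hl, hl.trans hij]

/-- The chart `φ^k_e : [γ, x]_k ↦ (e x, (e ∘ γ)'(0), …, (e ∘ γ)⁽ᵏ⁾(0)/k!)` of `T^kM`. -/
def chart {k : ℕ} (e : atlas E M) (u : OscBundle E M k) : E × (Fin k → E) :=
  (e.1 u.proj, fun i => coord e u (i + 1))

/-- The topology of `T^kM`: a basis consists of the sets that correspond to open sets
under the charts `φ^k_e` of the sets `π⁻¹(U_e)`. -/
instance (k : ℕ) : TopologicalSpace (OscBundle E M k) :=
  TopologicalSpace.generateFrom
    {S | ∃ (e : atlas E M) (W : Set (E × (Fin k → E))), IsOpen W ∧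
      S = proj ⁻¹' e.1.source ∩ chart e ⁻¹' W}

/-- The fibre coordinates `(z¹, …, z^k)` of the vector bundle trivialization `Φ^k_e` of `T^kM`
defined by a linear connection. -/
def trivFiber [IsManifold 𝓘(ℝ, E) ∞ M] (K : LinearConnection E M) {k : ℕ} (e : atlas E M) (u : OscBundle E M k) :
    Fin k → E :=
  fun i => zCoord (K.christoffel e) (coord e u) (i + 1)

end OscBundle

/-- Composition of a smooth map with a curve. -/
def CurveGerm.comp {E' N : Type*} [NormedAddCommGroup E'] [NormedSpace ℝ E']
    [TopologicalSpace N] [ChartedSpace E' N]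
    {g : M → N} (hg : ContMDiff 𝓘(ℝ, E) 𝓘(ℝ, E') ∞ g) (γ : CurveGerm E M) : CurveGerm E' N where
  toFun := g ∘ γ.toFun
  smooth := by
    obtain ⟨ε, hε, h⟩ := γ.smooth
    exact ⟨ε, hε, hg.comp_contMDiffOn h⟩

theorem CurveGerm.contMDiffAt (γ : CurveGerm E M) :
    ContMDiffAt 𝓘(ℝ, ℝ) 𝓘(ℝ, E) ∞ γ.toFun 0 := by
  obtain ⟨ε, hε, h⟩ := γ.smooth
  exact h.contMDiffAt (Ioo_mem_nhds (by linarith) hε)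

/-- The class of `g ∘ γ` depends only on the class of `γ`. -/
theorem curveSetoid_comp {E' N : Type*} [NormedAddCommGroup E'] [NormedSpace ℝ E']
    [TopologicalSpace N] [ChartedSpace E' N]
    [IsManifold 𝓘(ℝ, E) ∞ M] [IsManifold 𝓘(ℝ, E') ∞ N]
    {g : M → N} (hg : ContMDiff 𝓘(ℝ, E) 𝓘(ℝ, E') ∞ g) (k : ℕ) (γ₁ γ₂ : CurveGerm E M)
    (h : (curveSetoid E M k).r γ₁ γ₂) :
    (curveSetoid E' N k).r (γ₁.comp hg) (γ₂.comp hg) := by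
  obtain ⟨h0, h⟩ := h
  refine ⟨congrArg g h0, fun e' he' j hj => ?_⟩
  have he'' : g (γ₁.toFun 0) ∈ e'.1.source := he'
  let c : OpenPartialHomeomorph M E := chartAt E (γ₁.toFun 0)
  have hc : c ∈ atlas E M := chart_mem_atlas E _
  have hx : γ₁.toFun 0 ∈ c.source := mem_chart_source E _
  have hcm : c ∈ IsManifold.maximalAtlas 𝓘(ℝ, E) ∞ M := IsManifold.subset_maximalAtlas hc
  have hem : e'.1 ∈ IsManifold.maximalAtlas 𝓘(ℝ, E') ∞ N := IsManifold.subset_maximalAtlas e'.2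
  let F : E → E' := e'.1 ∘ g ∘ c.symm
  have hF : ContDiffAt ℝ ∞ F (c (γ₁.toFun 0)) := by
    rw [← contMDiffAt_iff_contDiffAt]
    have h1 : ContMDiffAt 𝓘(ℝ, E) 𝓘(ℝ, E) ∞ c.symm (c (γ₁.toFun 0)) :=
      contMDiffAt_symm_of_mem_maximalAtlas hcm (c.map_source hx)
    have h2 : ContMDiffAt 𝓘(ℝ, E') 𝓘(ℝ, E') ∞ e'.1 (g (c.symm (c (γ₁.toFun 0)))) :=
      contMDiffAt_of_mem_maximalAtlas hem (by rwa [c.left_inv hx])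
    exact h2.comp (c (γ₁.toFun 0)) ((hg _).comp (c (γ₁.toFun 0)) h1)
  have key : ∀ γ : CurveGerm E M, γ.toFun 0 = γ₁.toFun 0 →
      iteratedDeriv j (e'.1 ∘ g ∘ γ.toFun) 0 =
        ∑ p : OrderedFinpartition j, iteratedFDeriv ℝ p.length F (c (γ₁.toFun 0)) fun i =>
          iteratedDeriv (p.partSize i) (c ∘ γ.toFun) 0 := by
    intro γ hγ
    have hsm : ContDiffAt ℝ ∞ (c ∘ γ.toFun) 0 := by
      rw [← contMDiffAt_iff_contDiffAt]
      exact (contMDiffAt_of_mem_maximalAtlas hcm (by rw [hγ]; exact hx)).comp _ γ.contMDiffAt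
    have hev : (e'.1 ∘ g ∘ γ.toFun) =ᶠ[𝓝 0] F ∘ (c ∘ γ.toFun) := by
      have : γ.toFun ⁻¹' c.source ∈ 𝓝 (0 : ℝ) :=
        γ.contMDiffAt.continuousAt.preimage_mem_nhds
          (c.open_source.mem_nhds (by rw [hγ]; exact hx))
      filter_upwards [this] with t ht
      simp only [F, Function.comp_apply]
      rw [c.left_inv ht]
    rw [hev.iteratedDeriv_eq]
    have hF' : ContDiffAt ℝ ∞ F ((c ∘ γ.toFun) 0) := by
      simpa [hγ] using hF
    rw [iteratedDeriv_vcomp_eq_sum_orderedFinpartition hF' hsm (i := j)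
      (by exact_mod_cast le_top)]
    simp [hγ]
  change iteratedDeriv j (e'.1 ∘ g ∘ γ₁.toFun) 0 = iteratedDeriv j (e'.1 ∘ g ∘ γ₂.toFun) 0
  rw [key γ₁ rfl, key γ₂ h0.symm]
  refine Finset.sum_congr rfl fun p _ => ?_
  congr 1
  funext i
  exact h ⟨c, hc⟩ hx _ ((p.partSize_le i).trans hj)

/-- The `k`-th order differential `T^kg : T^kM → T^kN`, `[γ, x]_k ↦ [g ∘ γ, g x]_k`. -/
def OscBundle.map {E' N : Type*} [NormedAddCommGroup E'] [NormedSpace ℝ E']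
    [TopologicalSpace N] [ChartedSpace E' N]
    [IsManifold 𝓘(ℝ, E) ∞ M] [IsManifold 𝓘(ℝ, E') ∞ N]
    {g : M → N} (hg : ContMDiff 𝓘(ℝ, E) 𝓘(ℝ, E') ∞ g) (k : ℕ) :
    OscBundle E M k → OscBundle E' N k :=
  Quotient.map (CurveGerm.comp hg) (curveSetoid_comp hg k)

end OsculatingBundles

/-! ## Projective limits of Banach spaces and the spaces `H` -/

section ProjectiveLimits

variable (B B' : Type*) [NormedAddCommGroup B] [NormedSpace ℝ B]
  [NormedAddCommGroup B'] [NormedSpace ℝ B']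

/-- The projection `ρ_{ji} : B^j → B^i` to the first `i` factors. -/
def rho {i j : ℕ} (hij : i ≤ j) : (Fin j → B) →L[ℝ] (Fin i → B) :=
  ContinuousLinearMap.pi fun l => ContinuousLinearMap.proj (Fin.castLE hij l)

/-- The Fréchet space `F = lim B^k`, with the topology induced from the product. -/
def limPow : Submodule ℝ ((k : ℕ) → (Fin k → B)) where
  carrier := {v | ∀ (i j : ℕ) (hij : i ≤ j), rho B hij (v j) = v i}
  add_mem' := fun ha hb i j hij => by simp [ha i j hij, hb i j hij]
  zero_mem' := fun i j hij => by simp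
  smul_mem' := fun c a ha i j hij => by simp [ha i j hij]

/-- The Fréchet space `H(F, F')` of projective systems of continuous linear maps
`l_k : B^k → B'^k`. -/
def ProjHom : Submodule ℝ ((k : ℕ) → ((Fin k → B) →L[ℝ] (Fin k → B'))) where
  carrier := {l | ∀ (i j : ℕ) (hij : i ≤ j), (rho B' hij).comp (l j) = (l i).comp (rho B hij)}
  add_mem' := fun ha hb i j hij => by
    simp [ha i j hij, hb i j hij]
  zero_mem' := fun i j hij => by simp
  smul_mem' := fun c a ha i j hij => by
    simp [ha i j hij]

/-- The Banach space `H^k(B^k, B'^k)` of projective systems `(l_i)_{i ≤ k}`. -/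
def ProjHomFin (k : ℕ) :
    Submodule ℝ ((i : Fin (k + 1)) → ((Fin (i : ℕ) → B) →L[ℝ] (Fin (i : ℕ) → B'))) where
  carrier := {l | ∀ (i j : Fin (k + 1)) (hij : (i : ℕ) ≤ (j : ℕ)),
    (rho B' hij).comp (l j) = (l i).comp (rho B hij)}
  add_mem' := fun ha hb i j hij => by
    simp [ha i j hij, hb i j hij]
  zero_mem' := fun i j hij => by simp
  smul_mem' := fun c a ha i j hij => by
    simp [ha i j hij]

variable {B B'}

/-- The projection `H(F, F') → H^k(B^k, B'^k)`, `(l_i)_i ↦ (l_i)_{i ≤ k}`. -/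
def ProjHom.factor (k : ℕ) (l : ProjHom B B') : ProjHomFin B B' k :=
  ⟨fun i => l.1 i, fun i j hij => l.2 i j hij⟩

/-- The map `ε : H(F, F') → L(F, F')`, `(l_k)_k ↦ lim l_k`. -/
def ProjHom.eps (l : ProjHom B B') : limPow B →L[ℝ] limPow B' where
  toFun v := ⟨fun k => l.1 k (v.1 k), fun i j hij => by
    have h := congrArg (fun f => f (v.1 j)) (l.2 i j hij)
    simp only [ContinuousLinearMap.comp_apply] at h
    rw [h, v.2 i j hij]⟩
  map_add' v w := by
    ext1; funext k; simp
  map_smul' c v := by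
    ext1; funext k; simp
  cont := by
    refine Continuous.subtype_mk (continuous_pi fun k => ?_) _
    exact (l.1 k).continuous.comp ((continuous_apply k).comp continuous_subtype_val)

/-- Generalized smoothness of a map into `H(F, F') = lim H^k(B^k, B'^k)`: all its factors, which
are maps into Banach spaces, are smooth. -/
def GenSmoothOn {A : Type*} [NormedAddCommGroup A] [NormedSpace ℝ A]
    (h : A → ProjHom B B') (s : Set A) : Prop :=
  ∀ k : ℕ, ContDiffOn ℝ ∞ (fun x => ProjHom.factor k (h x)) s

end ProjectiveLimits

/-! ## Generalized (Fréchet) vector bundles and their morphisms -/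

section GeneralizedBundles

/-- A map `π : X → M` together with a candidate for a local trivialization
`Φ_e : π⁻¹(U_e) → e(U_e) × F`, `F = lim B^k`, over each chart domain `U_e` of `M`. -/
structure GenBundleData (E M B X : Type*) [NormedAddCommGroup E] [TopologicalSpace M]
    [ChartedSpace E M] [NormedAddCommGroup B] [NormedSpace ℝ B] where
  proj : X → M
  triv : atlas E M → X → E × limPow B

variable {E M B X : Type*} [NormedAddCommGroup E] [NormedSpace ℝ E]
  [TopologicalSpace M] [ChartedSpace E M] [NormedAddCommGroup B] [NormedSpace ℝ B]
  [TopologicalSpace X]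
  {E' N B' X' : Type*} [NormedAddCommGroup E'] [NormedSpace ℝ E']
  [TopologicalSpace N] [ChartedSpace E' N] [NormedAddCommGroup B'] [NormedSpace ℝ B']
  [TopologicalSpace X']

/-- `X` is a generalized vector bundle of fibre type `F = lim B^k` over `M`: the `Φ_e` are
homeomorphisms `π⁻¹(U_e) → e(U_e) × F` over the charts of `M`, and the transition maps are linear
on the fibres and factor smoothly through `H(F, F)`. -/
structure GenBundleData.IsGenVectorBundle (P : GenBundleData E M B X) : Prop where
  fst_triv : ∀ (e : atlas E M) (u : X), P.proj u ∈ e.1.source → (P.triv e u).1 = e.1 (P.proj u)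
  isHomeo : ∀ e : atlas E M, ∃ Θ : OpenPartialHomeomorph X (E × limPow B),
    Θ.source = P.proj ⁻¹' e.1.source ∧ Θ.target = e.1.target ×ˢ univ ∧
      EqOn Θ (P.triv e) Θ.source
  transition : ∀ e e' : atlas E M, ∃ h : E → ProjHom B B,
    GenSmoothOn h (e.1 '' (e.1.source ∩ e'.1.source)) ∧
    ∀ u : X, P.proj u ∈ e.1.source → P.proj u ∈ e'.1.source →
      (P.triv e' u).2 = ProjHom.eps (h (e.1 (P.proj u))) (P.triv e u).2

/-- `(G, g)` is a generalized vector bundle morphism: `g` is smooth, `G` is continuous and maps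
fibres over `x` to fibres over `g x`, and in all pairs of trivializations `Φ` of `P`, `Ψ` of `Q` the
local form `x ↦ Ψ_{g x} ∘ G_x ∘ Φ_x⁻¹ ∈ L(F, F')` is the composition of `ε` with a
generalized smooth map into `H(F, F')`. -/
structure IsGenVBMorphism (P : GenBundleData E M B X) (Q : GenBundleData E' N B' X')
    (G : X → X') (g : M → N) : Prop where
  smooth_base : ContMDiff 𝓘(ℝ, E) 𝓘(ℝ, E') ∞ g
  continuous_total : Continuous G
  proj_comp : ∀ u : X, Q.proj (G u) = g (P.proj u)
  local_form : ∀ (e : atlas E M) (e' : atlas E' N), ∃ h : E → ProjHom B B',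
    GenSmoothOn h (e.1 '' (e.1.source ∩ g ⁻¹' e'.1.source)) ∧
    ∀ u : X, P.proj u ∈ e.1.source → g (P.proj u) ∈ e'.1.source →
      (Q.triv e' (G u)).2 = ProjHom.eps (h (e.1 (P.proj u))) (P.triv e u).2

/-- A generalized vector bundle isomorphism: a morphism with an inverse morphism. -/
def IsGenVBIsomorphism (P : GenBundleData E M B X) (Q : GenBundleData E' N B' X')
    (G : X → X') (g : M → N) : Prop :=
  IsGenVBMorphism P Q G g ∧ ∃ (G' : X' → X) (g' : N → M), IsGenVBMorphism Q P G' g' ∧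
    Function.LeftInverse G' G ∧ Function.RightInverse G' G ∧
    Function.LeftInverse g' g ∧ Function.RightInverse g' g

end GeneralizedBundles

/-! ## The bundle of infinite order -/

section InfiniteOrder

/-- `T^∞M = lim T^kM`: the threads `(u_k)_k` with `π^{j,i}(u_j) = u_i`. -/
@[ext]
structure TInf (E M : Type*) [NormedAddCommGroup E] [NormedSpace ℝ E]
    [TopologicalSpace M] [ChartedSpace E M] where
  level : (k : ℕ) → OscBundle E M k
  compat : ∀ (i j : ℕ) (hij : i ≤ j), OscBundle.res hij (level j) = level i

variable {E M : Type*} [NormedAddCommGroup E] [NormedSpace ℝ E]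
  [TopologicalSpace M] [ChartedSpace E M]

/-- The topology of the projective limit, induced from the product of the `T^kM`. -/
instance : TopologicalSpace (TInf E M) := TopologicalSpace.induced TInf.level inferInstance

/-- The projection `π^∞ : T^∞M → M` (all levels of a thread have the same base point). -/
def TInf.proj (u : TInf E M) : M := (u.level 0).proj

variable [IsManifold 𝓘(ℝ, E) ∞ M]

theorem zCoord_congr {E : Type*} [NormedAddCommGroup E] [NormedSpace ℝ E]
    (Γ : E → E →L[ℝ] E →L[ℝ] E) {ξ ξ' : ℕ → E} {m : ℕ} (h : ∀ l ≤ m, ξ l = ξ' l) :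
    zCoord Γ ξ m = zCoord Γ ξ' m := by
  unfold zCoord
  congr 1
  refine Finset.sum_congr rfl fun j hj => ?_
  have hj' : j < m := Finset.mem_range.1 hj
  rw [h (m - j) (Nat.sub_le _ _)]
  congr 2
  funext i
  exact h i (by have := i.2; omega)

/-- The fibre part of `Φ^∞_e = lim Φ^k_e`. -/
def TInf.trivFiber (K : LinearConnection E M) (e : atlas E M) (u : TInf E M) : limPow E :=
  ⟨fun k => OscBundle.trivFiber K e (u.level k), fun i j hij => by
    funext l
    change zCoord _ (OscBundle.coord e (u.level j)) (l + 1) =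
      zCoord _ (OscBundle.coord e (u.level i)) (l + 1)
    refine zCoord_congr _ fun m hm => ?_
    rw [← u.compat i j hij, OscBundle.coord_res hij e (u.level j) (by have := l.2; omega)]⟩

/-- `T^∞M` with the trivializations `Φ^∞_e` defined by a linear connection on `M`. -/
def TInf.bundle (K : LinearConnection E M) : GenBundleData E M E (TInf E M) where
  proj := TInf.proj
  triv e u := (e.1 u.proj, TInf.trivFiber K e u)

/-- `T^∞g = lim T^kg`, mapping the thread `([γ, x]_k)_k` to `([g ∘ γ, g x]_k)_k`. -/
def TInf.map {E' N : Type*} [NormedAddCommGroup E'] [NormedSpace ℝ E']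
    [TopologicalSpace N] [ChartedSpace E' N] [IsManifold 𝓘(ℝ, E') ∞ N]
    {g : M → N} (hg : ContMDiff 𝓘(ℝ, E) 𝓘(ℝ, E') ∞ g) (u : TInf E M) : TInf E' N :=
  ⟨fun k => OscBundle.map hg k (u.level k), fun i j hij => by
    rw [← u.compat i j hij]
    induction u.level j using Quotient.inductionOn with
    | h γ => rfl⟩

end InfiniteOrder

end

/-! The coordinates `z` are iterated covariant derivatives in disguise: along a curve `γ` in a
chart, z^{k+1} = (1/(k+1)!) ∇^k γ', where ∇V = V' + Γ(γ)(γ', V). This is `zCoord_taylorCoeff`, a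
consequence of the Leibniz-type expansion `iterate_covDeriv_eq`; the recursion defining M^k is
exactly what that expansion requires.

Let F be the local representative of `g`. Relatedness of the connections, read in charts, says that
dF(Γ(ξ, y)) = D²F(y, ξ) + Γ'(dF ξ, dF y) (`LinearConnection.Related.christoffelRelated`), so ∇
commutes with dF, and hence z^k of F ∘ γ is dF applied to z^k of `γ`
(`ChristoffelRelated.zCoord_comp`). In the trivializations T^∞g is therefore dF acting on every
factor separately. This map is linear on fibres, compatible with the projections, and smooth in the
base point because A ↦ A × ⋯ × A is a bounded linear map. Transition maps are the case g = id, and a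
diffeomorphism is handled by applying the same result to its inverse, which also relates the
connections.

That the trivializations are homeomorphisms is a triangularity argument: z^{m+1} = ξ_{m+1} + (an
expression in ξ_0, …, ξ_m), by `zCoord_eq_add`. The Taylor coefficients are recovered recursively
and continuously (`invZCoord`), and every sequence of coefficients starting in the chart's image
comes from a thread of jets of polynomial curves. -/

noncomputable section

/-! ### Covariant derivatives along curves and the coordinates z. -/

section CovariantDerivative

variable {E : Type*} [NormedAddCommGroup E] [NormedSpace ℝ E]

theorem ContDiffOn.iteratedDeriv_of_isOpen {f : ℝ → E} {s : Set ℝ} (hs : IsOpen s)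
    (hf : ContDiffOn ℝ ∞ f s) (n : ℕ) : ContDiffOn ℝ ∞ (iteratedDeriv n f) s := by
  induction n generalizing f with
  | zero => simpa using hf
  | succ n ih =>
    rw [iteratedDeriv_succ']
    exact ih (hf.deriv_of_isOpen hs (by simp))

/-- The Taylor coefficients `γ⁽ⁿ⁾(t)/n!`. -/
def taylorCoeff (γ : ℝ → E) (t : ℝ) (n : ℕ) : E := ((n.factorial : ℝ))⁻¹ • iteratedDeriv n γ t

theorem taylorCoeff_zero (γ : ℝ → E) (t : ℝ) : taylorCoeff γ t 0 = γ t := by simp [taylorCoeff]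

theorem taylorCoeff_one (γ : ℝ → E) (t : ℝ) : taylorCoeff γ t 1 = deriv γ t := by
  simp [taylorCoeff]

theorem taylorCoeff_deriv (γ : ℝ → E) (t : ℝ) (n : ℕ) :
    taylorCoeff (deriv γ) t n = ((n : ℝ) + 1) • taylorCoeff γ t (n + 1) := by
  have h : ((n : ℝ) + 1) ≠ 0 := by positivity
  have h' : (n.factorial : ℝ) ≠ 0 := by positivity
  simp only [taylorCoeff, iteratedDeriv_succ', smul_smul, Nat.factorial_succ]
  congr 1
  push_cast
  field_simp

theorem hasDerivAt_taylorCoeff {γ : ℝ → E} {s : Set ℝ} (hs : IsOpen s) (hγ : ContDiffOn ℝ ∞ γ s)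
    {t : ℝ} (ht : t ∈ s) (n : ℕ) :
    HasDerivAt (fun t => taylorCoeff γ t n) (((n : ℝ) + 1) • taylorCoeff γ t (n + 1)) t := by
  have h := ((hγ.iteratedDeriv_of_isOpen hs n).differentiableOn (by simp)).differentiableAt
    (hs.mem_nhds ht)
  have h1 := h.hasDerivAt.const_smul ((n.factorial : ℝ))⁻¹
  have h2 : ((n : ℝ) + 1) • taylorCoeff γ t (n + 1) =
      ((n.factorial : ℝ))⁻¹ • deriv (iteratedDeriv n γ) t := by
    rw [← taylorCoeff_deriv, taylorCoeff, ← iteratedDeriv_succ', iteratedDeriv_succ]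
  rw [h2]
  exact h1

/-- Only the base variable has to lie in `T`, so the domain is open at every order and the
derivative in the recursion stays smooth on it. -/
theorem contDiffOn_connectionCoeff {Γ : E → E →L[ℝ] E →L[ℝ] E} {T : Set E} (hT : IsOpen T)
    (hΓ : ContDiffOn ℝ ∞ Γ T) (k : ℕ) :
    ContDiffOn ℝ ∞ (connectionCoeff Γ k) {u | u 0 ∈ T} := by
  induction k with
  | zero => exact contDiffOn_const
  | succ k ih =>
    have hopen : IsOpen {u : Fin (k + 1) → E | u 0 ∈ T} := hT.preimage (continuous_apply 0)
    have hinit : ContDiff ℝ ∞ (fun u : Fin (k + 2) → E => (Fin.init u : Fin (k + 1) → E)) :=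
      contDiff_pi.2 fun i => contDiff_apply ℝ E _
    have hmaps : MapsTo (fun u : Fin (k + 2) → E => (Fin.init u : Fin (k + 1) → E))
        {u | u 0 ∈ T} {u | u 0 ∈ T} := fun u hu => hu
    have h1 := (ih.fderiv_of_isOpen hopen (m := ∞) (by simp)).comp hinit.contDiffOn hmaps
    have h2 : ContDiff ℝ ∞ (fun u : Fin (k + 2) → E =>
        (fun i : Fin (k + 1) => ((i : ℝ) + 1) • u i.succ)) :=
      contDiff_pi.2 fun i => (contDiff_apply ℝ E _).const_smul _
    have h3 := ih.comp hinit.contDiffOn hmaps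
    have h4 : ContDiffOn ℝ ∞ (fun u : Fin (k + 2) → E => Γ (u 0) (u 1)) {u | u 0 ∈ T} :=
      (hΓ.comp (contDiff_apply ℝ E _).contDiffOn fun u hu => hu).clm_apply
        (contDiff_apply ℝ E _).contDiffOn
    exact ((h1.clm_apply h2.contDiffOn).add (h4.clm_comp h3)).const_smul _

/-- The covariant derivative of a vector field `V` along a curve `γ`. -/
def covDeriv (Γ : E → E →L[ℝ] E →L[ℝ] E) (γ V : ℝ → E) (t : ℝ) : E :=
  deriv V t + Γ (γ t) (deriv γ t) (V t)

theorem covDeriv_congr {Γ : E → E →L[ℝ] E →L[ℝ] E} {γ V W : ℝ → E} {s : Set ℝ} (hs : IsOpen s)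
    (h : EqOn V W s) : EqOn (covDeriv Γ γ V) (covDeriv Γ γ W) s := fun t ht => by
  have : V =ᶠ[𝓝 t] W := h.eventuallyEq_of_mem (hs.mem_nhds ht)
  simp only [covDeriv, this.deriv_eq, h ht]

theorem contDiffOn_covDeriv {Γ : E → E →L[ℝ] E →L[ℝ] E} {T : Set E}
    (hΓ : ContDiffOn ℝ ∞ Γ T) {γ V : ℝ → E} {s : Set ℝ} (hs : IsOpen s)
    (hγ : ContDiffOn ℝ ∞ γ s) (hm : MapsTo γ s T) (hV : ContDiffOn ℝ ∞ V s) :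
    ContDiffOn ℝ ∞ (covDeriv Γ γ V) s :=
  (hV.deriv_of_isOpen hs (by simp)).add
    (((hΓ.comp hγ hm).clm_apply (hγ.deriv_of_isOpen hs (by simp))).clm_apply hV)

theorem contDiffOn_iterate_covDeriv {Γ : E → E →L[ℝ] E →L[ℝ] E} {T : Set E}
    (hΓ : ContDiffOn ℝ ∞ Γ T) {γ V : ℝ → E} {s : Set ℝ} (hs : IsOpen s)
    (hγ : ContDiffOn ℝ ∞ γ s) (hm : MapsTo γ s T) (hV : ContDiffOn ℝ ∞ V s) (k : ℕ) :
    ContDiffOn ℝ ∞ ((covDeriv Γ γ)^[k] V) s := by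
  induction k with
  | zero => exact hV
  | succ k ih =>
    rw [Function.iterate_succ_apply']
    exact contDiffOn_covDeriv hΓ hs hγ hm ih

/-- The recursion with denominator cleared and all truncations of one sequence `ξ`; this is the form
in which it absorbs the derivative of M^k along a jet. -/
theorem connectionCoeff_succ_smul (Γ : E → E →L[ℝ] E →L[ℝ] E) (ξ : ℕ → E) (k : ℕ) (y : E) :
    ((k : ℝ) + 1) • connectionCoeff Γ (k + 1) (fun i => ξ i) y =
      fderiv ℝ (connectionCoeff Γ k) (fun i => ξ i) (fun i => ((i : ℝ) + 1) • ξ (i + 1)) y +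
        Γ (ξ 0) (ξ 1) (connectionCoeff Γ k (fun i => ξ i) y) := by
  have h : ((k : ℝ) + 1) ≠ 0 := by positivity
  simp only [connectionCoeff, smul_apply, smul_smul, mul_inv_cancel₀ h,
    one_smul]
  rfl

/-- Induction on `k`. Since ξ_i' = (i + 1) ξ_{i+1}, differentiating M^j(ξ) and adding the Γ-term
gives (j + 1) M^{j+1}, while differentiating the Taylor coefficient of `V` gives a factor k + 1 - j.
After reindexing, each M^j carries the weight j + (k + 1 - j) = k + 1, which turns k! into (k + 1)!.
-/
theorem iterate_covDeriv_eq {Γ : E → E →L[ℝ] E →L[ℝ] E} {T : Set E} (hT : IsOpen T)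
    (hΓ : ContDiffOn ℝ ∞ Γ T) {γ V : ℝ → E} {s : Set ℝ} (hs : IsOpen s)
    (hγ : ContDiffOn ℝ ∞ γ s) (hm : MapsTo γ s T) (hV : ContDiffOn ℝ ∞ V s) (k : ℕ) :
    EqOn ((covDeriv Γ γ)^[k] V) (fun t => (k.factorial : ℝ) • ∑ j ∈ Finset.range (k + 1),
      connectionCoeff Γ j (fun i => taylorCoeff γ t i) (taylorCoeff V t (k - j))) s := by
  induction k with
  | zero =>
    intro t ht
    simp [connectionCoeff, taylorCoeff]
  | succ k ih =>
    intro t ht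
    rw [Function.iterate_succ_apply', covDeriv_congr hs ih ht]
    set c : ℕ → E := taylorCoeff V t with hc
    set ξ : ℕ → E := taylorCoeff γ t with hξ
    have hderiv : ∀ j ∈ Finset.range (k + 1), HasDerivAt
        (fun t => connectionCoeff Γ j (fun i => taylorCoeff γ t i) (taylorCoeff V t (k - j)))
        (fderiv ℝ (connectionCoeff Γ j) (fun i => ξ i) (fun i => ((i : ℝ) + 1) • ξ (i + 1))
          (c (k - j)) + connectionCoeff Γ j (fun i => ξ i)
            ((((k - j : ℕ) : ℝ) + 1) • c (k - j + 1))) t := by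
      intro j _
      have h1 : HasDerivAt (fun t => (fun i : Fin (j + 1) => taylorCoeff γ t i))
          (fun i : Fin (j + 1) => ((i : ℝ) + 1) • ξ (i + 1)) t :=
        hasDerivAt_pi.2 fun i => hasDerivAt_taylorCoeff hs hγ ht i
      have hmem : (fun i : Fin (j + 1) => ξ i) ∈ {u : Fin (j + 1) → E | u 0 ∈ T} := by
        simpa [hξ, taylorCoeff_zero] using hm ht
      have h2 := (((contDiffOn_connectionCoeff hT hΓ j).differentiableOn
        (by simp)).differentiableAt
          ((hT.preimage (continuous_apply 0)).mem_nhds hmem)).hasFDerivAt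
      have h3 : HasDerivAt (fun t => connectionCoeff Γ j (fun i => taylorCoeff γ t i))
          (fderiv ℝ (connectionCoeff Γ j) (fun i => ξ i) (fun i => ((i : ℝ) + 1) • ξ (i + 1))) t :=
        HasFDerivAt.comp_hasDerivAt t h2 h1
      have h4 := hasDerivAt_taylorCoeff hs hV ht (k - j)
      exact HasDerivAt.clm_apply h3 h4
    have hsum := (HasDerivAt.fun_sum hderiv).fun_const_smul (k.factorial : ℝ)
    have hd : deriv γ t = ξ 1 := (taylorCoeff_one γ t).symm
    have h0 : γ t = ξ 0 := (taylorCoeff_zero γ t).symm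
    simp only [covDeriv]
    rw [hsum.deriv, hd, h0, map_smul, map_sum, ← smul_add, ← Finset.sum_add_distrib]
    have hterm : ∀ j ∈ Finset.range (k + 1),
        fderiv ℝ (connectionCoeff Γ j) (fun i => ξ i) (fun i => ((i : ℝ) + 1) • ξ (i + 1))
          (c (k - j)) + connectionCoeff Γ j (fun i => ξ i)
            ((((k - j : ℕ) : ℝ) + 1) • c (k - j + 1)) +
          Γ (ξ 0) (ξ 1) (connectionCoeff Γ j (fun i => ξ i) (c (k - j))) =
        ((j + 1 : ℕ) : ℝ) • connectionCoeff Γ (j + 1) (fun i => ξ i) (c (k + 1 - (j + 1))) +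
          ((k : ℝ) + 1 - j) • connectionCoeff Γ j (fun i => ξ i) (c (k + 1 - j)) := by
      intro j hj
      have hj' : j ≤ k := Nat.lt_succ_iff.1 (Finset.mem_range.1 hj)
      have e1 : k + 1 - (j + 1) = k - j := by omega
      have e2 : k + 1 - j = k - j + 1 := by omega
      rw [e1, e2, Nat.cast_succ, connectionCoeff_succ_smul, map_smul, Nat.cast_sub hj']
      rw [show (k : ℝ) - j + 1 = k + 1 - j by ring]
      abel
    rw [Finset.sum_congr rfl hterm, Finset.sum_add_distrib]
    -- Both sums can be taken over `range (k + 2)`: the added term j = 0 here, and j = k + 1 in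
    -- `s2`, has coefficient zero.
    have s1 : ∑ j ∈ Finset.range (k + 1),
        ((j + 1 : ℕ) : ℝ) • connectionCoeff Γ (j + 1) (fun i => ξ i) (c (k + 1 - (j + 1))) =
        ∑ j ∈ Finset.range (k + 2),
          (j : ℝ) • connectionCoeff Γ j (fun i => ξ i) (c (k + 1 - j)) := by
      rw [Finset.sum_range_succ' _ (k + 1)]
      simp
    have s2 : ∑ j ∈ Finset.range (k + 1),
        ((k : ℝ) + 1 - j) • connectionCoeff Γ j (fun i => ξ i) (c (k + 1 - j)) =
        ∑ j ∈ Finset.range (k + 2),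
          ((k : ℝ) + 1 - j) • connectionCoeff Γ j (fun i => ξ i) (c (k + 1 - j)) := by
      rw [Finset.sum_range_succ _ (k + 1)]
      simp
    rw [s1, s2, ← Finset.sum_add_distrib]
    simp only [← add_smul]
    simp only [add_sub_cancel]
    rw [← Finset.smul_sum, smul_smul, Nat.factorial_succ]
    push_cast
    rw [mul_comm]

/-- The previous expansion for V = γ': the factors m - j in `zCoord` are those relating the Taylor
coefficients of γ' to those of `γ`. -/
theorem zCoord_taylorCoeff {Γ : E → E →L[ℝ] E →L[ℝ] E} {T : Set E} (hT : IsOpen T)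
    (hΓ : ContDiffOn ℝ ∞ Γ T) {γ : ℝ → E} {s : Set ℝ} (hs : IsOpen s)
    (hγ : ContDiffOn ℝ ∞ γ s) (hm : MapsTo γ s T) (k : ℕ) {t : ℝ} (ht : t ∈ s) :
    zCoord Γ (taylorCoeff γ t) (k + 1) =
      (((k + 1).factorial : ℝ))⁻¹ • (covDeriv Γ γ)^[k] (deriv γ) t := by
  rw [iterate_covDeriv_eq hT hΓ hs hγ hm (hγ.deriv_of_isOpen hs (by simp)) k ht, smul_smul,
    zCoord]
  have h' : (k.factorial : ℝ) ≠ 0 := by positivity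
  congr 1
  · rw [Nat.factorial_succ]
    push_cast
    field_simp
  · refine Finset.sum_congr rfl fun j hj => ?_
    have hj' : j ≤ k := Nat.lt_succ_iff.1 (Finset.mem_range.1 hj)
    rw [taylorCoeff_deriv, show k + 1 - j = k - j + 1 by omega, Nat.cast_sub hj']
    push_cast
    rw [show (k : ℝ) - j + 1 = k + 1 - j by ring]

variable {E' : Type*} [NormedAddCommGroup E'] [NormedSpace ℝ E']

/-- `Γ` and `Γ'` are related by `F` on `T`: the local form of `K_N ∘ TTg = Tg ∘ K_M`. -/
def ChristoffelRelated (Γ : E → E →L[ℝ] E →L[ℝ] E) (Γ' : E' → E' →L[ℝ] E' →L[ℝ] E')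
    (F : E → E') (T : Set E) : Prop :=
  ∀ x ∈ T, ∀ ξ y : E, fderiv ℝ F x (Γ x ξ y) =
    fderiv ℝ (fderiv ℝ F) x y ξ + Γ' (F x) (fderiv ℝ F x ξ) (fderiv ℝ F x y)

/-- Differentiating dF(γ)V produces D²F(γ', V), whereas relatedness supplies D²F(V, γ'); symmetry of
the second derivative matches them. -/
theorem ChristoffelRelated.covDeriv_comp {Γ : E → E →L[ℝ] E →L[ℝ] E}
    {Γ' : E' → E' →L[ℝ] E' →L[ℝ] E'} {F : E → E'} {T : Set E} (hT : IsOpen T)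
    (hF : ContDiffOn ℝ ∞ F T) (hrel : ChristoffelRelated Γ Γ' F T)
    {γ V : ℝ → E} {t : ℝ} (hm : γ t ∈ T) (hγ : DifferentiableAt ℝ γ t)
    (hV : DifferentiableAt ℝ V t) :
    covDeriv Γ' (F ∘ γ) (fun t => fderiv ℝ F (γ t) (V t)) t =
      fderiv ℝ F (γ t) (covDeriv Γ γ V t) := by
  have hFt : ContDiffAt ℝ ∞ F (γ t) := hF.contDiffAt (hT.mem_nhds hm)
  have h1 : HasDerivAt (F ∘ γ) (fderiv ℝ F (γ t) (deriv γ t)) t :=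
    (hFt.differentiableAt (by simp)).hasFDerivAt.comp_hasDerivAt t hγ.hasDerivAt
  have h2 : HasDerivAt (fun t => fderiv ℝ F (γ t)) (fderiv ℝ (fderiv ℝ F) (γ t) (deriv γ t)) t :=
    ((hFt.fderiv_right (m := ∞) (by simp)).differentiableAt
      (by simp)).hasFDerivAt.comp_hasDerivAt t hγ.hasDerivAt
  have h3 := h2.clm_apply hV.hasDerivAt
  have hsymm : fderiv ℝ (fderiv ℝ F) (γ t) (deriv γ t) (V t) =
      fderiv ℝ (fderiv ℝ F) (γ t) (V t) (deriv γ t) :=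
    (hFt.isSymmSndFDerivAt (by simpa using WithTop.coe_le_coe.2 (le_top : (2 : ℕ∞) ≤ ⊤))) _ _
  simp only [covDeriv]
  rw [h3.deriv, h1.deriv, map_add, hrel _ hm, hsymm]
  rw [add_comm (fderiv ℝ (fderiv ℝ F) (γ t) (V t) (deriv γ t)), add_assoc]
  rfl

/-- The chain rule gives (F ∘ γ)' = dF(γ'), and dF commutes with each further covariant derivative.
-/
theorem ChristoffelRelated.zCoord_comp {Γ : E → E →L[ℝ] E →L[ℝ] E}
    {Γ' : E' → E' →L[ℝ] E' →L[ℝ] E'} {F : E → E'} {T : Set E} {T' : Set E'} (hT : IsOpen T)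
    (hT' : IsOpen T') (hF : ContDiffOn ℝ ∞ F T) (hFT : MapsTo F T T')
    (hΓ : ContDiffOn ℝ ∞ Γ T) (hΓ' : ContDiffOn ℝ ∞ Γ' T') (hrel : ChristoffelRelated Γ Γ' F T)
    {γ : ℝ → E} {s : Set ℝ} (hs : IsOpen s) (hγ : ContDiffOn ℝ ∞ γ s) (hm : MapsTo γ s T)
    (k : ℕ) {t : ℝ} (ht : t ∈ s) :
    zCoord Γ' (taylorCoeff (F ∘ γ) t) (k + 1) =
      fderiv ℝ F (γ t) (zCoord Γ (taylorCoeff γ t) (k + 1)) := by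
  have hγ' : ContDiffOn ℝ ∞ (F ∘ γ) s := hF.comp hγ hm
  have hiter : ∀ k, EqOn ((covDeriv Γ' (F ∘ γ))^[k] (deriv (F ∘ γ)))
      (fun t => fderiv ℝ F (γ t) ((covDeriv Γ γ)^[k] (deriv γ) t)) s := by
    intro k
    induction k with
    | zero =>
      intro t ht
      exact ((((hF.contDiffAt (hT.mem_nhds (hm ht))).differentiableAt
        (by simp)).hasFDerivAt).comp_hasDerivAt t
        ((hγ.differentiableOn (by simp)).differentiableAt (hs.mem_nhds ht)).hasDerivAt).deriv
    | succ k ih =>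
      intro t ht
      simp only [Function.iterate_succ_apply']
      rw [covDeriv_congr hs ih ht]
      exact hrel.covDeriv_comp hT hF (hm ht)
        ((hγ.differentiableOn (by simp)).differentiableAt (hs.mem_nhds ht))
        (((contDiffOn_iterate_covDeriv hΓ hs hγ hm (hγ.deriv_of_isOpen hs (by simp))
          k).differentiableOn (by simp)).differentiableAt (hs.mem_nhds ht))
  rw [zCoord_taylorCoeff hT' hΓ' hs hγ' (hFT.comp hm) k ht,
    zCoord_taylorCoeff hT hΓ hs hγ hm k ht, hiter k ht, map_smul]

end CovariantDerivative

/-! ### Locality, functoriality and coordinate form of TTf. -/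

section DoubleTangentMaps

variable {E M : Type*} [NormedAddCommGroup E] [NormedSpace ℝ E]
  [TopologicalSpace M] [ChartedSpace E M] [IsManifold 𝓘(ℝ, E) ∞ M]
  {E' N : Type*} [NormedAddCommGroup E'] [NormedSpace ℝ E']
  [TopologicalSpace N] [ChartedSpace E' N] [IsManifold 𝓘(ℝ, E') ∞ N]
  {E'' P : Type*} [NormedAddCommGroup E''] [NormedSpace ℝ E'']
  [TopologicalSpace P] [ChartedSpace E'' P] [IsManifold 𝓘(ℝ, E'') ∞ P]

/-- The second tangent map `TTf`. -/
abbrev doubleTangentMap (f : M → N) : DoubleTangent E M → DoubleTangent E' N :=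
  tangentMap 𝓘(ℝ, E).tangent 𝓘(ℝ, E').tangent (tangentMap 𝓘(ℝ, E) 𝓘(ℝ, E') f)

omit [IsManifold 𝓘(ℝ, E) ∞ M] [IsManifold 𝓘(ℝ, E') ∞ N] in
theorem tangentMap_congr_of_eventuallyEq {f f' : M → N} {p : TangentBundle 𝓘(ℝ, E) M}
    (h : f =ᶠ[𝓝 p.proj] f') :
    tangentMap 𝓘(ℝ, E) 𝓘(ℝ, E') f p = tangentMap 𝓘(ℝ, E) 𝓘(ℝ, E') f' p := by
  have h1 : mfderiv 𝓘(ℝ, E) 𝓘(ℝ, E') f p.proj = mfderiv 𝓘(ℝ, E) 𝓘(ℝ, E') f' p.proj := h.mfderiv_eq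
  -- All fibres are definitionally the model space, so the heterogeneous equality reduces to an
  -- ordinary one.
  refine Bundle.TotalSpace.ext h.eq_of_nhds (heq_of_eq ?_)
  exact congrArg (fun L : E →L[ℝ] E' => L p.snd) h1

/-- Charts are smooth only on open sets, so smoothness is taken from `tangentMapWithin`, which
agrees with `tangentMap` over `s`. -/
theorem mdifferentiableAt_tangentMap {f : M → N} {s : Set M} (hs : IsOpen s)
    (hf : ContMDiffOn 𝓘(ℝ, E) 𝓘(ℝ, E') ∞ f s) {p : TangentBundle 𝓘(ℝ, E) M} (hp : p.proj ∈ s) :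
    MDifferentiableAt 𝓘(ℝ, E).tangent 𝓘(ℝ, E').tangent (tangentMap 𝓘(ℝ, E) 𝓘(ℝ, E') f) p := by
  have hs' : IsOpen (Bundle.TotalSpace.proj ⁻¹' s : Set (TangentBundle 𝓘(ℝ, E) M)) :=
    hs.preimage (FiberBundle.continuous_proj E _)
  have h := (hf.contMDiffOn_tangentMapWithin (m := ∞) (by simp) hs.uniqueMDiffOn).contMDiffAt
    (hs'.mem_nhds hp)
  have h2 := h.mdifferentiableAt (by simp)
  refine h2.congr_of_eventuallyEq ?_
  filter_upwards [hs'.mem_nhds hp] with q hq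
  exact (tangentMapWithin_eq_tangentMap (hs.uniqueMDiffOn _ hq)
    ((hf.contMDiffAt (hs.mem_nhds hq)).mdifferentiableAt (by simp))).symm

theorem doubleTangentMap_congr {f f' : M → N} {s : Set M} (hs : IsOpen s) (h : EqOn f f' s)
    {w : DoubleTangent E M} (hw : w.proj.proj ∈ s) :
    doubleTangentMap (E := E) (E' := E') f w = doubleTangentMap f' w := by
  have hs' : IsOpen (Bundle.TotalSpace.proj ⁻¹' s : Set (TangentBundle 𝓘(ℝ, E) M)) :=
    hs.preimage (FiberBundle.continuous_proj E _)
  have h1 : tangentMap 𝓘(ℝ, E) 𝓘(ℝ, E') f =ᶠ[𝓝 w.proj] tangentMap 𝓘(ℝ, E) 𝓘(ℝ, E') f' := by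
    filter_upwards [hs'.mem_nhds hw] with q hq
    exact tangentMap_congr_of_eventuallyEq (h.eventuallyEq_of_mem (hs.mem_nhds hq))
  have h2 := h1.mfderiv_eq (I := 𝓘(ℝ, E).tangent) (I' := 𝓘(ℝ, E').tangent)
  refine Bundle.TotalSpace.ext h1.eq_of_nhds (heq_of_eq ?_)
  exact congrArg (fun L : E × E →L[ℝ] E' × E' => L w.snd) h2

theorem doubleTangentMap_comp {f : M → N} {g : N → P} {s : Set M} {t : Set N} (hs : IsOpen s)
    (ht : IsOpen t) (hf : ContMDiffOn 𝓘(ℝ, E) 𝓘(ℝ, E') ∞ f s)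
    (hg : ContMDiffOn 𝓘(ℝ, E') 𝓘(ℝ, E'') ∞ g t) (hst : MapsTo f s t)
    {w : DoubleTangent E M} (hw : w.proj.proj ∈ s) :
    doubleTangentMap (E := E) (E' := E'') (g ∘ f) w =
      doubleTangentMap (E := E') (E' := E'') g (doubleTangentMap (E := E) (E' := E') f w) := by
  have hs' : IsOpen (Bundle.TotalSpace.proj ⁻¹' s : Set (TangentBundle 𝓘(ℝ, E) M)) :=
    hs.preimage (FiberBundle.continuous_proj E _)
  rw [doubleTangentMap, doubleTangentMap, doubleTangentMap, ← tangentMap_comp_at (I' := 𝓘(ℝ, E').tangent) w (mdifferentiableAt_tangentMap ht hg (hst hw))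
    (mdifferentiableAt_tangentMap hs hf hw)]
  have h1 : tangentMap 𝓘(ℝ, E) 𝓘(ℝ, E'') (g ∘ f) =ᶠ[𝓝 w.proj]
      tangentMap 𝓘(ℝ, E') 𝓘(ℝ, E'') g ∘ tangentMap 𝓘(ℝ, E) 𝓘(ℝ, E') f := by
    filter_upwards [hs'.mem_nhds hw] with q hq
    exact tangentMap_comp_at q
      ((hg.contMDiffAt (ht.mem_nhds (hst hq))).mdifferentiableAt (by simp))
      ((hf.contMDiffAt (hs.mem_nhds hq)).mdifferentiableAt (by simp))
  have h2 := h1.mfderiv_eq (I := 𝓘(ℝ, E).tangent) (I' := 𝓘(ℝ, E'').tangent)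
  refine Bundle.TotalSpace.ext h1.eq_of_nhds (heq_of_eq ?_)
  exact congrArg (fun L : E × E →L[ℝ] E'' × E'' => L w.snd) h2

theorem doubleTangentMap_id (w : DoubleTangent E M) :
    doubleTangentMap (id : M → M) w = w := by
  rw [doubleTangentMap, tangentMap_id, tangentMap_id]
  rfl

/-- The coordinates of an element of `TTE`. -/
def flatCoord (w : DoubleTangent E E) : (E × E) × (E × E) :=
  (Bundle.TotalSpace.toProd E E w.proj, w.snd)

/-- On vector spaces TF is (x, ξ) ↦ (F x, dF_x ξ), and TTF is obtained by differentiating this map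
in the direction (y, η). -/
theorem flatCoord_doubleTangentMap {F : E → E'} {T : Set E} (hT : IsOpen T)
    (hF : ContDiffOn ℝ ∞ F T) {x ξ y η : E} (hx : x ∈ T) :
    flatCoord (doubleTangentMap F (⟨⟨x, ξ⟩, ((y, η) : E × E)⟩ : DoubleTangent E E)) =
      ((F x, fderiv ℝ F x ξ),
        (fderiv ℝ F x y, fderiv ℝ (fderiv ℝ F) x y ξ + fderiv ℝ F x η)) := by
  have hmd : MDifferentiableAt 𝓘(ℝ, E).tangent 𝓘(ℝ, E').tangent
      (tangentMap 𝓘(ℝ, E) 𝓘(ℝ, E') F) (⟨x, ξ⟩ : TangentBundle 𝓘(ℝ, E) E) :=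
    mdifferentiableAt_tangentMap hT (contMDiffOn_iff_contDiffOn.2 hF) hx
  have hFx : ContDiffAt ℝ ∞ F x := hF.contDiffAt (hT.mem_nhds hx)
  have hd1 : HasFDerivAt F (fderiv ℝ F x) x := (hFx.differentiableAt (by simp)).hasFDerivAt
  have hd2 : HasFDerivAt (fderiv ℝ F) (fderiv ℝ (fderiv ℝ F) x) x :=
    ((hFx.fderiv_right (m := ∞) (by simp)).differentiableAt (by simp)).hasFDerivAt
  have hp : HasFDerivAt (fun q : E × E => (F q.1, fderiv ℝ F q.1 q.2)) _ (x, ξ) :=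
    (HasFDerivAt.comp (x, ξ) (f := Prod.fst) hd1 hasFDerivAt_fst).prodMk
      ((HasFDerivAt.comp (x, ξ) (f := Prod.fst) hd2 hasFDerivAt_fst).clm_apply hasFDerivAt_snd)
  have hsnd : (mfderiv 𝓘(ℝ, E).tangent 𝓘(ℝ, E').tangent (tangentMap 𝓘(ℝ, E) 𝓘(ℝ, E') F)
      (⟨x, ξ⟩ : TangentBundle 𝓘(ℝ, E) E) : E × E →L[ℝ] E' × E') =
      fderiv ℝ (fun q : E × E => (F q.1, fderiv ℝ F q.1 q.2)) (x, ξ) := by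
    refine hmd.mfderiv.trans ?_
    simp only [mfld_simps, writtenInExtChartAt, tangentMap, mfderiv_eq_fderiv]
    simp only [Prod.map_id, range_id, fderivWithin_univ]
    refine congrArg (fun f => fderiv ℝ f (x, ξ)) (funext fun q => Prod.ext rfl ?_)
    exact congrArg (fun L : E →L[ℝ] E' => L q.2) mfderiv_eq_fderiv
  have h3 : (doubleTangentMap F (⟨⟨x, ξ⟩, ((y, η) : E × E)⟩ : DoubleTangent E E)).snd =
      fderiv ℝ (fun q : E × E => (F q.1, fderiv ℝ F q.1 q.2)) (x, ξ) (y, η) :=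
    congrArg (fun L : E × E →L[ℝ] E' × E' => L (y, η)) hsnd
  refine Prod.ext ?_ ?_
  · simp only [flatCoord, tangentMap, Bundle.TotalSpace.toProd]
    rw [mfderiv_eq_fderiv]
    rfl
  · simp only [flatCoord]
    rw [h3, hp.fderiv]
    simp [add_comm]

end DoubleTangentMaps

/-! ### Local representatives and relatedness in charts. -/

section LocalRepresentatives

variable {E M : Type*} [NormedAddCommGroup E]
  [TopologicalSpace M] [ChartedSpace E M]
  {E' N : Type*} [NormedAddCommGroup E']
  [TopologicalSpace N] [ChartedSpace E' N]

/-- The local representative `e' ∘ g ∘ e⁻¹` of a map `g` in charts `e`, `e'`. -/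
def localRep (e : atlas E M) (e' : atlas E' N) (g : M → N) : E → E' := e'.1 ∘ g ∘ e.1.symm

/-- The domain `e(U_e ∩ g⁻¹(U_{e'}))` of the local representative. -/
def localDomain (e : atlas E M) (e' : atlas E' N) (g : M → N) : Set E :=
  e.1.target ∩ e.1.symm ⁻¹' (g ⁻¹' e'.1.source)

theorem image_eq_localDomain (e : atlas E M) (e' : atlas E' N) (g : M → N) :
    e.1 '' (e.1.source ∩ g ⁻¹' e'.1.source) = localDomain e e' g :=
  e.1.image_source_inter_eq' _

theorem isOpen_localDomain (e : atlas E M) (e' : atlas E' N) {g : M → N} (hg : Continuous g) :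
    IsOpen (localDomain e e' g) :=
  e.1.isOpen_inter_preimage_symm (e'.1.open_source.preimage hg)

theorem mem_localDomain {e : atlas E M} {e' : atlas E' N} {g : M → N} {x : M}
    (hx : x ∈ e.1.source) (hx' : g x ∈ e'.1.source) : e.1 x ∈ localDomain e e' g :=
  ⟨e.1.map_source hx, by simpa [e.1.left_inv hx] using hx'⟩

theorem mapsTo_localRep (e : atlas E M) (e' : atlas E' N) (g : M → N) :
    MapsTo (localRep e e' g) (localDomain e e' g) e'.1.target :=
  fun _ hx => e'.1.map_source hx.2

theorem localRep_apply {e : atlas E M} {e' : atlas E' N} {g : M → N} {x : M}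
    (hx : x ∈ e.1.source) : localRep e e' g (e.1 x) = e'.1 (g x) := by
  simp [localRep, e.1.left_inv hx]

variable [NormedSpace ℝ E] [NormedSpace ℝ E'] [IsManifold 𝓘(ℝ, E) ∞ M]
  [IsManifold 𝓘(ℝ, E') ∞ N]

theorem contMDiffOn_atlas (e : atlas E M) : ContMDiffOn 𝓘(ℝ, E) 𝓘(ℝ, E) ∞ e.1 e.1.source :=
  contMDiffOn_of_mem_maximalAtlas (IsManifold.subset_maximalAtlas e.2)

theorem contMDiffOn_atlas_symm (e : atlas E M) :
    ContMDiffOn 𝓘(ℝ, E) 𝓘(ℝ, E) ∞ e.1.symm e.1.target :=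
  contMDiffOn_symm_of_mem_maximalAtlas (IsManifold.subset_maximalAtlas e.2)

theorem contMDiffOn_localRep {g : M → N} (hg : ContMDiff 𝓘(ℝ, E) 𝓘(ℝ, E') ∞ g)
    (e : atlas E M) (e' : atlas E' N) :
    ContMDiffOn 𝓘(ℝ, E) 𝓘(ℝ, E') ∞ (localRep e e' g) (localDomain e e' g) :=
  (contMDiffOn_atlas e').comp
    (hg.comp_contMDiffOn ((contMDiffOn_atlas_symm e).mono inter_subset_left)) fun _ hx => hx.2

theorem contDiffOn_localRep {g : M → N} (hg : ContMDiff 𝓘(ℝ, E) 𝓘(ℝ, E') ∞ g)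
    (e : atlas E M) (e' : atlas E' N) :
    ContDiffOn ℝ ∞ (localRep e e' g) (localDomain e e' g) :=
  contMDiffOn_iff_contDiffOn.1 (contMDiffOn_localRep hg e e')

/-- The identity K_N ∘ TTg = Tg ∘ K_M is evaluated at the vector with coordinates (x, ξ; y, 0). The
left side gives D²F(y, ξ) + Γ'(dF ξ, dF y), the right side dF(Γ(ξ, y)). -/
theorem LinearConnection.Related.christoffelRelated {KM : LinearConnection E M}
    {KN : LinearConnection E' N} {g : M → N} (hg : ContMDiff 𝓘(ℝ, E) 𝓘(ℝ, E') ∞ g)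
    (hrel : KM.Related KN g) (e : atlas E M) (e' : atlas E' N) :
    ChristoffelRelated (KM.christoffel e) (KN.christoffel e') (localRep e e' g)
      (localDomain e e' g) := by
  intro x hx ξ y
  have hT := isOpen_localDomain e e' hg.continuous
  have hsymm := contMDiffOn_atlas_symm e
  have hgs : ContMDiffOn 𝓘(ℝ, E) 𝓘(ℝ, E') ∞ (g ∘ e.1.symm) (localDomain e e' g) :=
    hg.comp_contMDiffOn (hsymm.mono inter_subset_left)
  have hxM : e.1.symm x ∈ e.1.source := e.1.map_target hx.1
  -- Taking η = 0 isolates the Christoffel terms.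
  let q : DoubleTangent E E := ⟨⟨x, ξ⟩, ((y, 0) : E × E)⟩
  let w : DoubleTangent E M := doubleTangentMap e.1.symm q
  have hwM : w.proj.proj ∈ e.1.source := hxM
  have hwN : (doubleTangentMap (E := E) (E' := E') g w).proj.proj ∈ e'.1.source := hx.2
  have hcoord : doubleTangentCoord e w = ((x, ξ), (y, 0)) := by
    have h1 : doubleTangentMap (E := E) (E' := E) e.1 w = q := by
      rw [← doubleTangentMap_comp e.1.open_target e.1.open_source hsymm (contMDiffOn_atlas e)
        e.1.symm.mapsTo (w := q) hx.1]
      have hid : EqOn (e.1 ∘ e.1.symm) id e.1.target := fun z hz => e.1.right_inv hz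
      rw [doubleTangentMap_congr e.1.open_target hid (w := q) hx.1, doubleTangentMap_id]
    exact congrArg flatCoord h1
  have hcoord' : doubleTangentCoord e' (doubleTangentMap (E := E) (E' := E') g w) =
      flatCoord (doubleTangentMap (E := E) (E' := E') (localRep e e' g) q) := by
    have h1 : doubleTangentMap (E := E) (E' := E') (g ∘ e.1.symm) q =
        doubleTangentMap (E := E) (E' := E') g w :=
      doubleTangentMap_comp hT isOpen_univ (hsymm.mono inter_subset_left) hg.contMDiffOn
        (mapsTo_univ _ _) (w := q) hx
    have h2 : doubleTangentMap (E := E) (E' := E') (localRep e e' g) q =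
        doubleTangentMap (E := E') (E' := E') e'.1
          (doubleTangentMap (E := E) (E' := E') (g ∘ e.1.symm) q) :=
      doubleTangentMap_comp hT e'.1.open_source hgs (contMDiffOn_atlas e')
        (fun z hz => hz.2) (w := q) hx
    rw [h2, h1]
    rfl
  rw [flatCoord_doubleTangentMap hT (contDiffOn_localRep hg e e') hx] at hcoord'
  have hM := KM.local_form e w hwM _ _ _ _ hcoord
  have hN := KN.local_form e' _ hwN _ _ _ _ hcoord'
  rw [hrel w] at hN
  have hproj : (KM.toFun w).proj = e.1.symm x := KM.proj_toFun w
  have hv : (KM.toFun w).proj ∈ e.1.source := hproj ▸ hxM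
  let v := KM.toFun w
  have hTe : tangentMap 𝓘(ℝ, E) 𝓘(ℝ, E) e.1 v = ⟨x, KM.christoffel e x ξ y⟩ := by
    refine (Bundle.TotalSpace.toProd E E).injective ?_
    refine hM.trans ?_
    rw [zero_add]
    rfl
  have hTF : tangentMap 𝓘(ℝ, E') 𝓘(ℝ, E') e'.1 (tangentMap 𝓘(ℝ, E) 𝓘(ℝ, E') g v) =
      tangentMap 𝓘(ℝ, E) 𝓘(ℝ, E') (localRep e e' g)
        (tangentMap 𝓘(ℝ, E) 𝓘(ℝ, E) e.1 v) := by
    have hgx : g v.proj ∈ e'.1.source := by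
      change g (KM.toFun w).proj ∈ _
      rw [hproj]
      exact hx.2
    have hed : MDifferentiableAt 𝓘(ℝ, E) 𝓘(ℝ, E) e.1 v.proj :=
      ((contMDiffOn_atlas e).contMDiffAt (e.1.open_source.mem_nhds hv)).mdifferentiableAt (by simp)
    have he'd : MDifferentiableAt 𝓘(ℝ, E') 𝓘(ℝ, E') e'.1 (g v.proj) :=
      ((contMDiffOn_atlas e').contMDiffAt
        (e'.1.open_source.mem_nhds hgx)).mdifferentiableAt (by simp)
    have hFd : MDifferentiableAt 𝓘(ℝ, E) 𝓘(ℝ, E') (localRep e e' g) (e.1 v.proj) :=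
      ((contMDiffOn_localRep hg e e').contMDiffAt
        (hT.mem_nhds (mem_localDomain hv hgx))).mdifferentiableAt (by simp)
    rw [← tangentMap_comp_at v he'd ((hg _).mdifferentiableAt (by simp)),
      ← tangentMap_comp_at v hFd hed]
    refine tangentMap_congr_of_eventuallyEq ?_
    filter_upwards [e.1.open_source.mem_nhds hv] with z hz
    exact (localRep_apply hz).symm
  have hfin : tangentCoord e' (tangentMap 𝓘(ℝ, E) 𝓘(ℝ, E') g v) =
      (localRep e e' g x, fderiv ℝ (localRep e e' g) x (KM.christoffel e x ξ y)) := by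
    rw [tangentCoord, hTF, hTe]
    refine Prod.ext rfl ?_
    exact congrArg (fun L : E →L[ℝ] E' => L (KM.christoffel e x ξ y)) mfderiv_eq_fderiv
  have := congrArg Prod.snd (hfin.symm.trans hN)
  simpa using this

theorem LinearConnection.related_id (K : LinearConnection E M) : K.Related K id := by
  intro w
  simp only [tangentMap_id]
  rfl

/-- Relatedness is applied at TTf⁻¹(w), and Tf⁻¹ then cancels Tf. -/
theorem LinearConnection.Related.symm {KM : LinearConnection E M}
    {KN : LinearConnection E' N} {f : Diffeomorph 𝓘(ℝ, E) 𝓘(ℝ, E') M N ∞}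
    (hrel : KM.Related KN f) : KN.Related KM f.symm := by
  have hcomp : ∀ w : DoubleTangent E' N,
      doubleTangentMap (E := E) (E' := E') f (doubleTangentMap f.symm w) = w := fun w => by
    rw [← doubleTangentMap_comp isOpen_univ isOpen_univ f.symm.contMDiff.contMDiffOn
      f.contMDiff.contMDiffOn (mapsTo_univ _ _) (w := w) (mem_univ _)]
    have : (f ∘ f.symm : N → N) = id := funext f.apply_symm_apply
    rw [this, doubleTangentMap_id]
  intro w
  have h := (congrArg KN.toFun (hcomp w)).symm.trans (hrel (doubleTangentMap f.symm w))
  rw [h, ← tangentMap_comp_at _ (f.symm.contMDiff.mdifferentiable (by simp) _)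
    (f.contMDiff.mdifferentiable (by simp) _)]
  have : (f.symm ∘ f : M → M) = id := funext f.symm_apply_apply
  rw [this, tangentMap_id]
  rfl

end LocalRepresentatives

/-! ### Jets of composites and of polynomial curves. -/

section Jets

variable {E E' : Type*} [NormedAddCommGroup E] [NormedSpace ℝ E]
  [NormedAddCommGroup E'] [NormedSpace ℝ E']

/-- The action of a smooth map on Taylor coefficients (formula of Faà di Bruno). -/
def jetMap (F : E → E') (ξ : ℕ → E) (j : ℕ) : E' :=
  ((j.factorial : ℝ))⁻¹ • ∑ p : OrderedFinpartition j, iteratedFDeriv ℝ p.length F (ξ 0) fun i =>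
    ((p.partSize i).factorial : ℝ) • ξ (p.partSize i)

theorem factorial_smul_taylorCoeff (γ : ℝ → E) (t : ℝ) (n : ℕ) :
    (n.factorial : ℝ) • taylorCoeff γ t n = iteratedDeriv n γ t := by
  rw [taylorCoeff, smul_smul, mul_inv_cancel₀ (by positivity), one_smul]

theorem taylorCoeff_comp {F : E → E'} {γ : ℝ → E} {t : ℝ} (hF : ContDiffAt ℝ ∞ F (γ t))
    (hγ : ContDiffAt ℝ ∞ γ t) (j : ℕ) :
    taylorCoeff (F ∘ γ) t j = jetMap F (taylorCoeff γ t) j := by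
  rw [taylorCoeff, iteratedDeriv_vcomp_eq_sum_orderedFinpartition hF hγ (i := j)
      (by exact_mod_cast le_top)]
  simp only [jetMap, factorial_smul_taylorCoeff, taylorCoeff_zero]

theorem jetMap_congr (F : E → E') {ξ ξ' : ℕ → E} {j : ℕ} (h : ∀ i ≤ j, ξ i = ξ' i) :
    jetMap F ξ j = jetMap F ξ' j := by
  simp only [jetMap]
  congr 1
  refine Finset.sum_congr rfl fun p _ => ?_
  rw [h 0 (Nat.zero_le _)]
  congr 1
  funext i
  rw [h _ (p.partSize_le i)]

theorem tendsto_jetMap {A : Type*} {l : Filter A} {F : E → E'} {ξ : A → ℕ → E} {η : ℕ → E} {j : ℕ}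
    (hF : ContDiffAt ℝ ∞ F (η 0)) (h : ∀ i ≤ j, Filter.Tendsto (fun a => ξ a i) l (𝓝 (η i))) :
    Filter.Tendsto (fun a => jetMap F (ξ a) j) l (𝓝 (jetMap F η j)) := by
  refine Filter.Tendsto.const_smul (tendsto_finsetSum _ fun p _ => ?_) _
  have h1 : ContinuousAt (iteratedFDeriv ℝ p.length F) (η 0) :=
    hF.continuousAt_iteratedFDeriv (by exact_mod_cast le_top)
  have h2 := h1.tendsto.comp (h 0 (Nat.zero_le _))
  have h3 : Filter.Tendsto (fun a (i : Fin p.length) =>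
      ((p.partSize i).factorial : ℝ) • ξ a (p.partSize i)) l
      (𝓝 fun i => ((p.partSize i).factorial : ℝ) • η (p.partSize i)) :=
    tendsto_pi_nhds.2 fun i => (h _ (p.partSize_le i)).const_smul _
  exact h2.eval h3

/-- The polynomial curve `t ↦ ∑_{i ≤ k} tⁱ ξᵢ`. -/
def polyCurve (ξ : ℕ → E) (k : ℕ) (t : ℝ) : E := ∑ i ∈ Finset.range (k + 1), t ^ i • ξ i

theorem polyCurve_zero (ξ : ℕ → E) (k : ℕ) : polyCurve ξ k 0 = ξ 0 := by
  simp [polyCurve, Finset.sum_range_succ']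

theorem contDiff_polyCurve (ξ : ℕ → E) (k : ℕ) : ContDiff ℝ ∞ (polyCurve ξ k) :=
  ContDiff.sum fun i _ => (contDiff_id.pow i).smul contDiff_const

theorem deriv_polyCurve (ξ : ℕ → E) (k : ℕ) :
    deriv (polyCurve ξ (k + 1)) = polyCurve (fun i => ((i : ℝ) + 1) • ξ (i + 1)) k := by
  funext t
  have h : ∀ i ∈ Finset.range (k + 2),
      HasDerivAt (fun t : ℝ => t ^ i • ξ i) (((i : ℝ) * t ^ (i - 1)) • ξ i) t :=
    fun i _ => (hasDerivAt_pow i t).smul_const (ξ i)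
  refine (HasDerivAt.fun_sum h).deriv.trans ?_
  rw [Finset.sum_range_succ']
  simp [polyCurve, smul_smul, mul_comm]

/-- Induction on `j`: differentiation shifts the coefficients of the polynomial and the Taylor
coefficients by the same rule. -/
theorem taylorCoeff_polyCurve (ξ : ℕ → E) {j k : ℕ} (hj : j ≤ k) :
    taylorCoeff (polyCurve ξ k) 0 j = ξ j := by
  induction j generalizing ξ k with
  | zero => rw [taylorCoeff_zero, polyCurve_zero]
  | succ j ih =>
    obtain ⟨k, rfl⟩ : ∃ k', k = k' + 1 := ⟨k - 1, by omega⟩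
    have h := taylorCoeff_deriv (polyCurve ξ (k + 1)) 0 j
    rw [deriv_polyCurve, ih _ (by omega)] at h
    exact (smul_right_injective E (by positivity : ((j : ℝ) + 1) ≠ 0) h).symm

theorem Filter.EventuallyEq.taylorCoeff_eq {γ γ' : ℝ → E} {t : ℝ} (h : γ =ᶠ[𝓝 t] γ') :
    taylorCoeff γ t = taylorCoeff γ' t :=
  funext fun n => by rw [taylorCoeff, taylorCoeff, h.iteratedDeriv_eq]

end Jets

/-! ### Coordinates and topology of T^kM. -/

namespace OscBundle

variable {E M : Type*} [NormedAddCommGroup E] [NormedSpace ℝ E]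
  [TopologicalSpace M] [ChartedSpace E M]
  {E' N : Type*} [NormedAddCommGroup E'] [NormedSpace ℝ E']
  [TopologicalSpace N] [ChartedSpace E' N]

/-- The class `[γ]_k`. -/
def mk (k : ℕ) (γ : CurveGerm E M) : OscBundle E M k := Quotient.mk _ γ

theorem coord_mk {k j : ℕ} {e : atlas E M} {γ : CurveGerm E M} (h : γ.toFun 0 ∈ e.1.source)
    (hj : j ≤ k) : coord e (mk k γ) j = taylorCoeff (e.1 ∘ γ.toFun) 0 j :=
  if_pos ⟨h, hj⟩

theorem coord_zero {k : ℕ} {e : atlas E M} {u : OscBundle E M k} (h : u.proj ∈ e.1.source) :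
    coord e u 0 = e.1 u.proj := by
  induction u using Quotient.inductionOn with
  | h γ => exact (coord_mk h (Nat.zero_le _)).trans (taylorCoeff_zero _ _)

theorem proj_eq_symm_coord {k : ℕ} {e : atlas E M} {u : OscBundle E M k}
    (h : u.proj ∈ e.1.source) : u.proj = e.1.symm (coord e u 0) := by
  rw [coord_zero h, e.1.left_inv h]

theorem isOpen_preimage_source (k : ℕ) (e : atlas E M) :
    IsOpen (proj ⁻¹' e.1.source : Set (OscBundle E M k)) :=
  TopologicalSpace.isOpen_generateFrom_of_mem ⟨e, univ, isOpen_univ, by simp⟩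

theorem continuousOn_chart (k : ℕ) (e : atlas E M) :
    ContinuousOn (chart e) (proj ⁻¹' e.1.source : Set (OscBundle E M k)) := by
  rw [continuousOn_open_iff (isOpen_preimage_source k e)]
  exact fun W hW => TopologicalSpace.isOpen_generateFrom_of_mem ⟨e, W, hW, rfl⟩

theorem continuousOn_coord {k j : ℕ} (hj : j ≤ k) (e : atlas E M) :
    ContinuousOn (fun u => coord e u j) (proj ⁻¹' e.1.source : Set (OscBundle E M k)) := by
  rcases j with _ | j
  · exact (continuous_fst.comp_continuousOn (continuousOn_chart k e)).congr
      fun u hu => coord_zero hu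
  · exact ((continuous_apply (⟨j, hj⟩ : Fin k)).comp continuous_snd).comp_continuousOn
      (continuousOn_chart k e)

theorem continuous_proj (k : ℕ) : Continuous (proj : OscBundle E M k → M) := by
  rw [continuous_iff_continuousAt]
  intro u
  let e : atlas E M := achart E u.proj
  have hu : u.proj ∈ e.1.source := mem_chart_source E u.proj
  have h : ContinuousOn (proj : OscBundle E M k → M) (proj ⁻¹' e.1.source) := by
    refine ContinuousOn.congr (f := fun u => e.1.symm (coord e u 0)) ?_
      fun u hu => proj_eq_symm_coord hu
    exact e.1.symm.continuousOn.comp (continuousOn_coord (Nat.zero_le _) e)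
      fun u hu => by rw [coord_zero hu]; exact e.1.map_source hu
  exact h.continuousAt ((isOpen_preimage_source k e).mem_nhds hu)

theorem res_proj {i j : ℕ} (hij : i ≤ j) (u : OscBundle E M j) : (res hij u).proj = u.proj := by
  induction u using Quotient.inductionOn with
  | h γ => rfl

omit [NormedSpace ℝ E'] in
theorem eventuallyEq_localRep_comp {g : M → N} (γ : CurveGerm E M) {e : atlas E M}
    {e' : atlas E' N} (he : γ.toFun 0 ∈ e.1.source) :
    e'.1 ∘ g ∘ γ.toFun =ᶠ[𝓝 0] localRep e e' g ∘ (e.1 ∘ γ.toFun) := by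
  have : γ.toFun ⁻¹' e.1.source ∈ 𝓝 (0 : ℝ) :=
    γ.contMDiffAt.continuousAt.preimage_mem_nhds (e.1.open_source.mem_nhds he)
  filter_upwards [this] with t ht
  exact (localRep_apply ht).symm

section Manifold

variable [IsManifold 𝓘(ℝ, E) ∞ M] [IsManifold 𝓘(ℝ, E') ∞ N]

theorem _root_.CurveGerm.exists_isOpen (γ : CurveGerm E M) {U : Set M} (hU : IsOpen U)
    (e : atlas E M) (hUe : U ⊆ e.1.source) (h0 : γ.toFun 0 ∈ U) :
    ∃ s : Set ℝ, IsOpen s ∧ 0 ∈ s ∧ MapsTo γ.toFun s U ∧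
      ContDiffOn ℝ ∞ (e.1 ∘ γ.toFun) s := by
  obtain ⟨ε, hε, h⟩ := γ.smooth
  refine ⟨Ioo (-ε) ε ∩ γ.toFun ⁻¹' U, h.continuousOn.isOpen_inter_preimage isOpen_Ioo hU,
    ⟨⟨by linarith, hε⟩, h0⟩, fun t ht => ht.2, ?_⟩
  exact contMDiffOn_iff_contDiffOn.1 ((contMDiffOn_atlas e).comp (h.mono inter_subset_left)
    fun t ht => hUe ht.2)

theorem coord_map {g : M → N} (hg : ContMDiff 𝓘(ℝ, E) 𝓘(ℝ, E') ∞ g) {k j : ℕ} (hj : j ≤ k)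
    {e : atlas E M} {e' : atlas E' N} {u : OscBundle E M k} (he : u.proj ∈ e.1.source)
    (he' : g u.proj ∈ e'.1.source) :
    coord e' (map hg k u) j = jetMap (localRep e e' g) (coord e u) j := by
  induction u using Quotient.inductionOn with
  | h γ =>
    change γ.toFun 0 ∈ e.1.source at he
    change g (γ.toFun 0) ∈ e'.1.source at he'
    have h1 : coord e' (map hg k (mk k γ)) j = taylorCoeff (e'.1 ∘ g ∘ γ.toFun) 0 j :=
      coord_mk (γ := γ.comp hg) he' hj
    refine h1.trans ?_
    obtain ⟨s, hs, h0, hm, hsm⟩ := γ.exists_isOpen e.1.open_source e subset_rfl he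
    rw [(eventuallyEq_localRep_comp γ he).taylorCoeff_eq, taylorCoeff_comp]
    · exact jetMap_congr _ fun i hi => (coord_mk he (hi.trans hj)).symm
    · exact (contDiffOn_localRep hg e e').contDiffAt
        ((isOpen_localDomain e e' hg.continuous).mem_nhds (mem_localDomain he he'))
    · exact hsm.contDiffAt (hs.mem_nhds h0)

theorem map_id (k : ℕ) (u : OscBundle E M k) : map contMDiff_id k u = u := by
  induction u using Quotient.inductionOn with
  | h γ => rfl

theorem proj_map {g : M → N} (hg : ContMDiff 𝓘(ℝ, E) 𝓘(ℝ, E') ∞ g) {k : ℕ}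
    (u : OscBundle E M k) : (map hg k u).proj = g u.proj := by
  induction u using Quotient.inductionOn with
  | h γ => rfl

theorem coord_change {k j : ℕ} (hj : j ≤ k) {e e' : atlas E M} {u : OscBundle E M k}
    (he : u.proj ∈ e.1.source) (he' : u.proj ∈ e'.1.source) :
    coord e' u j = jetMap (localRep e e' id) (coord e u) j := by
  have := coord_map contMDiff_id hj he (show id u.proj ∈ e'.1.source from he')
  rwa [map_id] at this

/-- Equality of classes asks for agreement in all charts; one chart suffices because the coordinates
in any other are a function (`jetMap`) of those in the first. -/
theorem ext_coord {k : ℕ} {u v : OscBundle E M k} {e : atlas E M} (hu : u.proj ∈ e.1.source)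
    (hv : v.proj ∈ e.1.source) (h : ∀ j ≤ k, coord e u j = coord e v j) : u = v := by
  have hproj : u.proj = v.proj := by
    rw [proj_eq_symm_coord hu, proj_eq_symm_coord hv, h 0 (Nat.zero_le _)]
  have key : ∀ (e' : atlas E M), u.proj ∈ e'.1.source → ∀ j ≤ k, coord e' u j = coord e' v j :=
    fun e' he' j hj => by
      rw [coord_change hj hu he', coord_change hj hv (hproj ▸ he')]
      exact jetMap_congr _ fun i hi => h i (hi.trans hj)
  induction u using Quotient.inductionOn with
  | h γ =>
  induction v using Quotient.inductionOn with
  | h γ' =>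
    refine Quotient.sound ⟨hproj, fun e' he' j hj => ?_⟩
    have h1 : γ'.toFun 0 ∈ e'.1.source := by
      have : γ.toFun 0 = γ'.toFun 0 := hproj
      exact this ▸ he'
    have h2 := key e' he' j hj
    rw [← factorial_smul_taylorCoeff, ← factorial_smul_taylorCoeff]
    exact congrArg _ (((coord_mk he' hj).symm.trans h2).trans (coord_mk h1 hj))

/-- The topology is generated by all charts, so a subbasic set may come from another chart `e'`;
continuity of the change of coordinates transfers the hypothesis to `e'`. -/
theorem continuousWithinAt_of_coord {A : Type*} [TopologicalSpace A] {k : ℕ}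
    {f : A → OscBundle E M k} {s : Set A} {a : A} (ha : a ∈ s) (e : atlas E M)
    (hs : ∀ b ∈ s, (f b).proj ∈ e.1.source)
    (h : ∀ j ≤ k, ContinuousWithinAt (fun b => coord e (f b) j) s a) :
    ContinuousWithinAt f s a := by
  refine TopologicalSpace.tendsto_nhds_generateFrom_iff.2 ?_
  rintro _ ⟨e', W, hW, rfl⟩ ⟨ha1, ha2⟩
  have hproj : ContinuousWithinAt (fun b => (f b).proj) s a := by
    refine ContinuousWithinAt.congr (f := fun b => e.1.symm (coord e (f b) 0)) ?_
      (fun b hb => proj_eq_symm_coord (hs b hb)) (proj_eq_symm_coord (hs a ha))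
    refine ContinuousAt.comp_continuousWithinAt ?_ (h 0 (Nat.zero_le _))
    refine e.1.symm.continuousAt ?_
    rw [coord_zero (hs a ha)]
    exact e.1.map_source (hs a ha)
  have hsrc : ∀ᶠ b in 𝓝[s] a, (f b).proj ∈ e'.1.source :=
    hproj.eventually (e'.1.open_source.mem_nhds ha1)
  have hF : ContDiffAt ℝ ∞ (localRep e e' id) (coord e (f a) 0) := by
    rw [coord_zero (hs a ha)]
    exact (contDiffOn_localRep contMDiff_id e e').contDiffAt
        ((isOpen_localDomain e e' continuous_id).mem_nhds (mem_localDomain (hs a ha) ha1))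
  have hcoord : ∀ j ≤ k, Filter.Tendsto (fun b => coord e' (f b) j) (𝓝[s] a)
      (𝓝 (coord e' (f a) j)) := fun j hj => by
    rw [coord_change hj (hs a ha) ha1]
    refine (tendsto_jetMap hF fun i hi => h i (hi.trans hj)).congr' ?_
    filter_upwards [hsrc, self_mem_nhdsWithin] with b hb hbs
    exact (coord_change hj (hs b hbs) hb).symm
  have hchart : Filter.Tendsto (fun b => chart e' (f b)) (𝓝[s] a) (𝓝 (chart e' (f a))) := by
    refine Filter.Tendsto.prodMk_nhds ?_ (tendsto_pi_nhds.2 fun i => hcoord _ i.2)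
    exact (e'.1.continuousAt ha1).tendsto.comp hproj
  filter_upwards [hsrc, hchart.eventually (hW.mem_nhds ha2)] with b hb1 hb2
  exact ⟨hb1, hb2⟩

theorem continuous_map {g : M → N} (hg : ContMDiff 𝓘(ℝ, E) 𝓘(ℝ, E') ∞ g) (k : ℕ) :
    Continuous (map hg k) := by
  rw [continuous_iff_continuousAt]
  intro u
  let e : atlas E M := achart E u.proj
  let e' : atlas E' N := achart E' (g u.proj)
  let s : Set (OscBundle E M k) := proj ⁻¹' (e.1.source ∩ g ⁻¹' e'.1.source)
  have hs : IsOpen s :=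
    (e.1.open_source.inter (e'.1.open_source.preimage hg.continuous)).preimage (continuous_proj k)
  have hu : u ∈ s := ⟨mem_chart_source E u.proj, mem_chart_source E' (g u.proj)⟩
  refine (continuousWithinAt_of_coord hu e' (fun v hv => by rw [proj_map]; exact hv.2)
    fun j hj => ?_).continuousAt (hs.mem_nhds hu)
  have hF : ContDiffAt ℝ ∞ (localRep e e' g) (coord e u 0) := by
    rw [coord_zero hu.1]
    exact (contDiffOn_localRep hg e e').contDiffAt
      ((isOpen_localDomain e e' hg.continuous).mem_nhds (mem_localDomain hu.1 hu.2))
  refine ContinuousWithinAt.congr (f := fun v => jetMap (localRep e e' g) (coord e v) j) ?_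
    (fun v hv => coord_map hg hj hv.1 hv.2) (coord_map hg hj hu.1 hu.2)
  exact tendsto_jetMap hF fun i hi => ((continuousOn_coord (hi.trans hj) e) u hu.1).mono
    fun v hv => hv.1

open Classical in
/-- A curve with Taylor coefficients `ξ₀, …, ξ_k` in the chart `e`, where `ξ₀ ∈ e(U_e)`. -/
def curveOfCoord (e : atlas E M) (ξ : ℕ → E) (k : ℕ) : CurveGerm E M where
  -- The default is a constant curve independent of `k`, so the classes form a thread for every `ξ`.
  toFun t := if ξ 0 ∈ e.1.target then e.1.symm (polyCurve ξ k t) else e.1.symm 0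
  smooth := by
    by_cases h : ξ 0 ∈ e.1.target
    · simp only [if_pos h]
      have h0 : polyCurve ξ k ⁻¹' e.1.target ∈ 𝓝 (0 : ℝ) :=
        (contDiff_polyCurve ξ k).continuous.continuousAt.preimage_mem_nhds
          (e.1.open_target.mem_nhds (by rwa [polyCurve_zero]))
      obtain ⟨ε, hε, hsub⟩ := Metric.mem_nhds_iff.1 h0
      rw [Real.ball_eq_Ioo, zero_sub, zero_add] at hsub
      exact ⟨ε, hε, (contMDiffOn_atlas_symm e).comp (contDiff_polyCurve ξ k).contMDiff.contMDiffOn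
        hsub⟩
    · simp only [if_neg h]
      exact ⟨1, one_pos, contMDiffOn_const⟩

variable {e : atlas E M} {ξ : ℕ → E} {k : ℕ}

theorem proj_mk_curveOfCoord (h : ξ 0 ∈ e.1.target) :
    (mk k (curveOfCoord e ξ k)).proj = e.1.symm (ξ 0) :=
  (if_pos h).trans (by rw [polyCurve_zero])

theorem proj_mk_curveOfCoord_mem (h : ξ 0 ∈ e.1.target) :
    (mk k (curveOfCoord e ξ k)).proj ∈ e.1.source := by
  rw [proj_mk_curveOfCoord h]
  exact e.1.map_target h

theorem coord_mk_curveOfCoord (h : ξ 0 ∈ e.1.target) {j : ℕ} (hj : j ≤ k) :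
    coord e (mk k (curveOfCoord e ξ k)) j = ξ j := by
  rw [coord_mk (proj_mk_curveOfCoord_mem (k := k) h) hj, ← taylorCoeff_polyCurve ξ hj]
  refine congrFun (Filter.EventuallyEq.taylorCoeff_eq ?_) j
  have h0 : polyCurve ξ k ⁻¹' e.1.target ∈ 𝓝 (0 : ℝ) :=
    (contDiff_polyCurve ξ k).continuous.continuousAt.preimage_mem_nhds
      (e.1.open_target.mem_nhds (by rwa [polyCurve_zero]))
  filter_upwards [h0] with t ht
  simp only [Function.comp_apply, curveOfCoord, if_pos h]
  exact e.1.right_inv ht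

/-- The curves of levels `i` and `j` are polynomials of different degree in the chart, but share
their Taylor coefficients up to order `i`. -/
theorem res_mk_curveOfCoord {i j : ℕ} (hij : i ≤ j) :
    res hij (mk j (curveOfCoord e ξ j)) = mk i (curveOfCoord e ξ i) := by
  by_cases h : ξ 0 ∈ e.1.target
  · refine ext_coord (e := e) (by rw [res_proj]; exact proj_mk_curveOfCoord_mem h)
      (proj_mk_curveOfCoord_mem h) fun l hl => ?_
    rw [coord_res hij _ _ hl, coord_mk_curveOfCoord h (hl.trans hij), coord_mk_curveOfCoord h hl]
  · have : curveOfCoord e ξ j = curveOfCoord e ξ i := by simp only [curveOfCoord, if_neg h]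
    rw [← this]
    rfl

end Manifold

end OscBundle

/-! ### Triangular inversion of the z-coordinates. -/

section FiberCoordinates

variable {E : Type*} [NormedAddCommGroup E] [NormedSpace ℝ E]
  (Γ : E → E →L[ℝ] E →L[ℝ] E)

/-- The coefficient ξ_{m+1} occurs only in the term j = 0, where M⁰ = id and the factor m + 1
cancels. Replacing it by zero kills that term and leaves the others unchanged. -/
theorem zCoord_eq_add (ξ : ℕ → E) (m : ℕ) :
    zCoord Γ ξ (m + 1) =
      ξ (m + 1) + zCoord Γ (fun i => if i ≤ m then ξ i else 0) (m + 1) := by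
  have hm : ((m : ℝ) + 1) ≠ 0 := by positivity
  have h1 : ∀ j ∈ Finset.range m,
      connectionCoeff Γ (j + 1) (fun i => ξ i)
          ((((m + 1 : ℕ) : ℝ) - (j + 1 : ℕ)) • ξ (m + 1 - (j + 1))) =
        connectionCoeff Γ (j + 1) (fun i => if (i : ℕ) ≤ m then ξ i else 0)
          ((((m + 1 : ℕ) : ℝ) - (j + 1 : ℕ)) •
            if m + 1 - (j + 1) ≤ m then ξ (m + 1 - (j + 1)) else 0) := by
    intro j hj
    have hj' : j < m := Finset.mem_range.1 hj
    rw [if_pos (by omega)]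
    congr 2
    funext i
    rw [if_pos (by have := i.2; omega)]
  rw [zCoord, zCoord, Finset.sum_range_succ', Finset.sum_range_succ', Finset.sum_congr rfl h1]
  simp only [connectionCoeff, ContinuousLinearMap.id_apply, smul_add]
  simp [smul_smul, inv_mul_cancel₀ hm, add_comm]

theorem tendsto_zCoord {Γ : E → E →L[ℝ] E →L[ℝ] E} {T : Set E} (hT : IsOpen T)
    (hΓ : ContDiffOn ℝ ∞ Γ T) {A : Type*} {l : Filter A} {ξ : A → ℕ → E} {η : ℕ → E} {m : ℕ}
    (hη : η 0 ∈ T) (h : ∀ i ≤ m, Filter.Tendsto (fun a => ξ a i) l (𝓝 (η i))) :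
    Filter.Tendsto (fun a => zCoord Γ (ξ a) m) l (𝓝 (zCoord Γ η m)) := by
  refine Filter.Tendsto.const_smul (tendsto_finsetSum _ fun j hj => ?_) _
  have hj' : j < m := Finset.mem_range.1 hj
  have h1 : ContinuousAt (connectionCoeff Γ j) (fun i => η i) :=
    (contDiffOn_connectionCoeff hT hΓ j).continuousOn.continuousAt
      ((hT.preimage (continuous_apply 0)).mem_nhds hη)
  have h2 : Filter.Tendsto (fun a (i : Fin (j + 1)) => ξ a i) l (𝓝 fun i => η i) :=
    tendsto_pi_nhds.2 fun i => h _ (by have := i.2; omega)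
  have h3 := (h _ (Nat.sub_le m j)).const_smul ((m : ℝ) - j)
  exact (isBoundedBilinearMap_apply.continuous.tendsto (connectionCoeff Γ j fun i => η i, _)).comp
    ((h1.tendsto.comp h2).prodMk_nhds h3)

/-- The Taylor coefficients `ξ` with `ξ₀ = x` and `zCoord Γ ξ (m + 1) = z m`. -/
def invZCoord (x : E) (z : ℕ → E) : ℕ → E
  | 0 => x
  -- The cut-off at `m` drops nothing that is needed and makes the recursion well-founded.
  | m + 1 => z m - zCoord Γ (fun i => if i ≤ m then invZCoord x z i else 0) (m + 1)

theorem invZCoord_zero (x : E) (z : ℕ → E) : invZCoord Γ x z 0 = x := by rw [invZCoord]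

theorem zCoord_invZCoord (x : E) (z : ℕ → E) (m : ℕ) :
    zCoord Γ (invZCoord Γ x z) (m + 1) = z m := by
  rw [zCoord_eq_add, invZCoord, sub_add_cancel]

/-- Triangularity gives uniqueness: each coefficient is determined by its z-coordinate and the
earlier coefficients. -/
theorem eq_invZCoord {ξ z : ℕ → E} {k : ℕ} (h : ∀ m < k, zCoord Γ ξ (m + 1) = z m) :
    ∀ j ≤ k, ξ j = invZCoord Γ (ξ 0) z j := by
  intro j
  induction j using Nat.strong_induction_on with
  | _ j ih =>
    intro hj
    rcases j with _ | m
    · rw [invZCoord_zero]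
    · rw [invZCoord, ← h m hj, zCoord_eq_add]
      have : (fun i => if i ≤ m then ξ i else 0) =
          fun i => if i ≤ m then invZCoord Γ (ξ 0) z i else 0 := by
        funext i
        split_ifs with hi
        · exact ih i (by omega) (by omega)
        · rfl
      rw [this, add_sub_cancel_right]

theorem tendsto_invZCoord {Γ : E → E →L[ℝ] E →L[ℝ] E} {T : Set E} (hT : IsOpen T)
    (hΓ : ContDiffOn ℝ ∞ Γ T) {A : Type*} {l : Filter A} {x : A → E} {z : A → ℕ → E}
    {x₀ : E} {z₀ : ℕ → E} (hx₀ : x₀ ∈ T) (hx : Filter.Tendsto x l (𝓝 x₀))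
    (hz : ∀ i, Filter.Tendsto (fun a => z a i) l (𝓝 (z₀ i))) (j : ℕ) :
    Filter.Tendsto (fun a => invZCoord Γ (x a) (z a) j) l (𝓝 (invZCoord Γ x₀ z₀ j)) := by
  induction j using Nat.strong_induction_on with
  | _ j ih =>
    rcases j with _ | m
    · simpa only [invZCoord_zero] using hx
    · simp only [invZCoord]
      refine (hz m).sub (tendsto_zCoord hT hΓ ?_ fun i _ => ?_)
      · simpa [invZCoord_zero] using hx₀
      · split_ifs with hi
        · exact ih i (by omega)
        · exact tendsto_const_nhds

end FiberCoordinates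

/-! ### Elements of lim B^k as sequences. -/

section LimPow

variable {B : Type*} [NormedAddCommGroup B] [NormedSpace ℝ B]

/-- The sequence `(z¹, z², …)` of the components of an element of `lim B^k`. -/
def limPow.seq (v : limPow B) (m : ℕ) : B := v.1 (m + 1) (Fin.last m)

theorem limPow.apply_eq_seq (v : limPow B) (k : ℕ) (i : Fin k) : v.1 k i = limPow.seq v i :=
  (congrFun (v.2 (i + 1) k i.2) (Fin.last i) :)

theorem limPow.continuous_seq (m : ℕ) : Continuous fun v : limPow B => limPow.seq v m :=
  (continuous_apply (Fin.last m)).comp ((continuous_apply (m + 1)).comp continuous_subtype_val)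

end LimPow

/-! ### Coordinates and trivializations of T^∞M, and T^∞g in coordinates. -/

namespace TInf

variable {E M : Type*} [NormedAddCommGroup E] [NormedSpace ℝ E]
  [TopologicalSpace M] [ChartedSpace E M]
  {E' N : Type*} [NormedAddCommGroup E'] [NormedSpace ℝ E']
  [TopologicalSpace N] [ChartedSpace E' N]

theorem continuous_level (k : ℕ) : Continuous fun u : TInf E M => u.level k :=
  (continuous_apply k).comp continuous_induced_dom

theorem continuousOn_iff_level {A : Type*} [TopologicalSpace A] {f : A → TInf E M} {s : Set A} :
    ContinuousOn f s ↔ ∀ k, ContinuousOn (fun a => (f a).level k) s := by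
  rw [Topology.IsInducing.continuousOn_iff (g := TInf.level) ⟨rfl⟩, continuousOn_pi]
  rfl

theorem continuous_proj : Continuous (TInf.proj : TInf E M → M) :=
  (OscBundle.continuous_proj 0).comp (continuous_level 0)

theorem proj_level (u : TInf E M) (k : ℕ) : (u.level k).proj = u.proj := by
  rw [TInf.proj, ← u.compat 0 k (Nat.zero_le _), OscBundle.res_proj]

/-- The `j`-th Taylor coefficient of an element of `T^∞M` in the chart `e`. -/
def coord (e : atlas E M) (u : TInf E M) (j : ℕ) : E := OscBundle.coord e (u.level j) j

theorem coord_level (e : atlas E M) (u : TInf E M) {j k : ℕ} (h : j ≤ k) :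
    OscBundle.coord e (u.level k) j = coord e u j := by
  rw [coord, ← u.compat j k h, OscBundle.coord_res h _ _ le_rfl]

theorem coord_zero {e : atlas E M} {u : TInf E M} (h : u.proj ∈ e.1.source) :
    coord e u 0 = e.1 u.proj :=
  OscBundle.coord_zero h

theorem continuousOn_coord (e : atlas E M) (j : ℕ) :
    ContinuousOn (fun u => coord e u j) (TInf.proj ⁻¹' e.1.source : Set (TInf E M)) :=
  (OscBundle.continuousOn_coord le_rfl e).comp (continuous_level j).continuousOn
    fun u hu => by
      change (u.level j).proj ∈ e.1.source
      rw [proj_level]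
      exact hu

theorem ext_coord [IsManifold 𝓘(ℝ, E) ∞ M] {u v : TInf E M} {e : atlas E M}
    (hu : u.proj ∈ e.1.source) (hv : v.proj ∈ e.1.source)
    (h : ∀ j, coord e u j = coord e v j) : u = v := by
  ext k
  refine OscBundle.ext_coord (e := e) (by rwa [proj_level]) (by rwa [proj_level]) fun j hj => ?_
  rw [coord_level e u hj, coord_level e v hj, h]

section Manifold

variable [IsManifold 𝓘(ℝ, E) ∞ M] [IsManifold 𝓘(ℝ, E') ∞ N]

theorem trivFiber_apply (K : LinearConnection E M) (e : atlas E M) (u : TInf E M) (k : ℕ)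
    (i : Fin k) : (TInf.trivFiber K e u).1 k i = zCoord (K.christoffel e) (coord e u) (i + 1) :=
  zCoord_congr _ fun l hl => coord_level e u (by have := i.2; omega)

theorem proj_map {g : M → N} (hg : ContMDiff 𝓘(ℝ, E) 𝓘(ℝ, E') ∞ g) (u : TInf E M) :
    (TInf.map hg u).proj = g u.proj :=
  OscBundle.proj_map hg _

theorem continuous_map {g : M → N} (hg : ContMDiff 𝓘(ℝ, E) 𝓘(ℝ, E') ∞ g) :
    Continuous (TInf.map hg) := by
  rw [← continuousOn_univ, continuousOn_iff_level]
  exact fun k => ((OscBundle.continuous_map hg k).comp (continuous_level k)).continuousOn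

theorem map_id (u : TInf E M) : TInf.map contMDiff_id u = u :=
  TInf.ext (funext fun k => OscBundle.map_id k (u.level k))

/-- The identity already holds for the representing curves. -/
theorem map_comp_eq_id {f : M → N} {g : N → M} (hf : ContMDiff 𝓘(ℝ, E) 𝓘(ℝ, E') ∞ f)
    (hg : ContMDiff 𝓘(ℝ, E') 𝓘(ℝ, E) ∞ g) (h : Function.LeftInverse g f) :
    Function.LeftInverse (TInf.map hg) (TInf.map hf) := by
  intro u
  ext k
  change OscBundle.map hg k (OscBundle.map hf k (u.level k)) = u.level k
  induction u.level k using Quotient.inductionOn with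
  | h γ =>
    have hγ : (γ.comp hf).comp hg = γ := by
      obtain ⟨γ, hs⟩ := γ
      simp only [CurveGerm.comp, CurveGerm.mk.injEq]
      exact funext fun t => h (γ t)
    exact congrArg (OscBundle.mk k) hγ

/-- The element of `T^∞M` with given Taylor coefficients in the chart `e`. -/
def ofCoord (e : atlas E M) (ξ : ℕ → E) : TInf E M :=
  ⟨fun k => OscBundle.mk k (OscBundle.curveOfCoord e ξ k),
    fun _ _ hij => OscBundle.res_mk_curveOfCoord hij⟩

theorem proj_ofCoord {e : atlas E M} {ξ : ℕ → E} (h : ξ 0 ∈ e.1.target) :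
    (ofCoord e ξ).proj = e.1.symm (ξ 0) :=
  OscBundle.proj_mk_curveOfCoord h

theorem proj_ofCoord_mem {e : atlas E M} {ξ : ℕ → E} (h : ξ 0 ∈ e.1.target) :
    (ofCoord e ξ).proj ∈ e.1.source :=
  OscBundle.proj_mk_curveOfCoord_mem h

/-- No Borel-type realization by a single curve is needed: a thread may use a different polynomial
at each level. -/
theorem coord_ofCoord {e : atlas E M} {ξ : ℕ → E} (h : ξ 0 ∈ e.1.target) :
    coord e (ofCoord e ξ) = ξ :=
  funext fun _ => OscBundle.coord_mk_curveOfCoord h le_rfl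

theorem continuousOn_ofCoord {A : Type*} [TopologicalSpace A] {e : atlas E M} {ξ : A → ℕ → E}
    {s : Set A} (hξ : ∀ j, ContinuousOn (fun a => ξ a j) s) (hs : ∀ a ∈ s, ξ a 0 ∈ e.1.target) :
    ContinuousOn (fun a => ofCoord e (ξ a)) s := by
  rw [continuousOn_iff_level]
  intro k a ha
  refine OscBundle.continuousWithinAt_of_coord ha e
    (fun b hb => OscBundle.proj_mk_curveOfCoord_mem (hs b hb)) fun j hj => ?_
  exact (hξ j a ha).congr (fun b hb => OscBundle.coord_mk_curveOfCoord (hs b hb) hj)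
    (OscBundle.coord_mk_curveOfCoord (hs a ha) hj)

theorem continuousOn_trivFiber (K : LinearConnection E M) (e : atlas E M) :
    ContinuousOn (TInf.trivFiber K e) (TInf.proj ⁻¹' e.1.source) := by
  rw [Topology.IsInducing.subtypeVal.continuousOn_iff, continuousOn_pi]
  intro k
  rw [continuousOn_pi]
  intro i
  refine ContinuousOn.congr (f := fun u => zCoord (K.christoffel e) (coord e u) (i + 1)) ?_
    fun u _ => trivFiber_apply K e u k i
  intro u hu
  refine tendsto_zCoord e.1.open_target (K.contDiffOn_christoffel e) ?_
    fun j _ => continuousOn_coord e j u hu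
  rw [coord_zero hu]
  exact e.1.map_source hu

/-- The trivialization `Φ^∞_e` as a homeomorphism `π⁻¹(U_e) → e(U_e) × lim E^k`. -/
def trivHomeo (K : LinearConnection E M) (e : atlas E M) :
    OpenPartialHomeomorph (TInf E M) (E × limPow E) where
  toFun u := (e.1 u.proj, TInf.trivFiber K e u)
  invFun p := ofCoord e (invZCoord (K.christoffel e) p.1 (limPow.seq p.2))
  source := TInf.proj ⁻¹' e.1.source
  target := e.1.target ×ˢ univ
  map_source' _ hu := ⟨e.1.map_source hu, mem_univ _⟩
  map_target' p hp := proj_ofCoord_mem (by rw [invZCoord_zero]; exact hp.1)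
  left_inv' u hu := by
    have h0 : invZCoord (K.christoffel e) (e.1 u.proj) (limPow.seq (TInf.trivFiber K e u)) 0 ∈
        e.1.target := by
      rw [invZCoord_zero]
      exact e.1.map_source hu
    refine ext_coord (e := e) (proj_ofCoord_mem h0) hu fun j => ?_
    rw [coord_ofCoord h0, ← coord_zero hu]
    -- Injectivity is the uniqueness part of the triangular inversion.
    exact (eq_invZCoord _ (k := j) (fun m _ =>
      (trivFiber_apply K e u (m + 1) (Fin.last m)).symm) j le_rfl).symm
  right_inv' p hp := by
    have h0 : invZCoord (K.christoffel e) p.1 (limPow.seq p.2) 0 ∈ e.1.target := by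
      rw [invZCoord_zero]
      exact hp.1
    refine Prod.ext ?_ (Subtype.ext (funext fun k => funext fun i => ?_))
    · change e.1 (ofCoord e _).proj = p.1
      rw [proj_ofCoord h0, e.1.right_inv h0, invZCoord_zero]
    · rw [trivFiber_apply, coord_ofCoord h0, zCoord_invZCoord, limPow.apply_eq_seq]
  open_source := e.1.open_source.preimage continuous_proj
  open_target := e.1.open_target.prod isOpen_univ
  continuousOn_toFun :=
    (e.1.continuousOn.comp continuous_proj.continuousOn fun _ hu => hu).prodMk
      (continuousOn_trivFiber K e)
  continuousOn_invFun := by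
    refine continuousOn_ofCoord (fun j p hp => ?_) fun p hp => by
      rw [invZCoord_zero]; exact hp.1
    exact tendsto_invZCoord e.1.open_target (K.contDiffOn_christoffel e) hp.1
      continuous_fst.continuousWithinAt
      (fun i => ((limPow.continuous_seq i).comp continuous_snd).continuousWithinAt) j

/-- Reduces the statement about threads to `ChristoffelRelated.zCoord_comp` for one curve. -/
theorem zCoord_coord_map {KM : LinearConnection E M} {KN : LinearConnection E' N} {g : M → N}
    (hg : ContMDiff 𝓘(ℝ, E) 𝓘(ℝ, E') ∞ g) (hrel : KM.Related KN g) {e : atlas E M}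
    {e' : atlas E' N} {u : TInf E M} (he : u.proj ∈ e.1.source) (he' : g u.proj ∈ e'.1.source)
    (k : ℕ) :
    zCoord (KN.christoffel e') (coord e' (TInf.map hg u)) (k + 1) =
      fderiv ℝ (localRep e e' g) (e.1 u.proj)
        (zCoord (KM.christoffel e) (coord e u) (k + 1)) := by
  -- z^{k+1} depends only on the jet of order k + 1, so a representative of that level suffices.
  obtain ⟨γ, hγ⟩ := Quotient.exists_rep (u.level (k + 1))
  change OscBundle.mk (k + 1) γ = _ at hγ
  have hγ0 : γ.toFun 0 = u.proj := by
    rw [← proj_level u (k + 1), ← hγ]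
    rfl
  rw [← hγ0] at he he'
  have hM : ∀ l ≤ k + 1, coord e u l = taylorCoeff (e.1 ∘ γ.toFun) 0 l := fun l hl => by
    rw [← coord_level e u hl, ← hγ, OscBundle.coord_mk he hl]
  have hN : ∀ l ≤ k + 1, coord e' (TInf.map hg u) l =
      taylorCoeff (localRep e e' g ∘ (e.1 ∘ γ.toFun)) 0 l := fun l hl => by
    rw [← (OscBundle.eventuallyEq_localRep_comp γ he).taylorCoeff_eq, ← coord_level e' _ hl]
    change OscBundle.coord e' (OscBundle.map hg (k + 1) (u.level (k + 1))) l = _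
    rw [← hγ]
    exact OscBundle.coord_mk (γ := γ.comp hg) he' hl
  -- The parameter set is shrunk so that the curve stays where the local representative is smooth.
  obtain ⟨s, hs, h0, hm, hsm⟩ := γ.exists_isOpen
    (e.1.open_source.inter (e'.1.open_source.preimage hg.continuous)) e inter_subset_left ⟨he, he'⟩
  rw [zCoord_congr _ hM, zCoord_congr _ hN, ← hγ0]
  exact (hrel.christoffelRelated hg e e').zCoord_comp
    (isOpen_localDomain e e' hg.continuous) e'.1.open_target (contDiffOn_localRep hg e e')
    (mapsTo_localRep e e' g) ((KM.contDiffOn_christoffel e).mono inter_subset_left)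
    (KN.contDiffOn_christoffel e') hs hsm
    (fun t ht => mem_localDomain (hm ht).1 (hm ht).2) k h0

end Manifold

end TInf

/-! ### Diagonal operators in H(F, F'). -/

section DiagonalHom

variable {B B' : Type*} [NormedAddCommGroup B] [NormedSpace ℝ B]
  [NormedAddCommGroup B'] [NormedSpace ℝ B']

/-- The operator `A × ⋯ × A : B^k → B'^k`. -/
def diagPow (k : ℕ) (A : B →L[ℝ] B') : (Fin k → B) →L[ℝ] (Fin k → B') :=
  ContinuousLinearMap.pi fun i => A.comp (ContinuousLinearMap.proj i)

/-- The projective system `(A × ⋯ × A)_k` in `H(F, F')`. -/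
def ProjHom.diag (A : B →L[ℝ] B') : ProjHom B B' :=
  ⟨fun k => diagPow k A, fun _ _ _ => rfl⟩

/-- The finite projective system `(A × ⋯ × A)_{i ≤ k}` as a function of `A`. -/
def ProjHomFin.diag (k : ℕ) : (B →L[ℝ] B') →ₗ[ℝ] ProjHomFin B B' k where
  toFun A := ⟨fun i => diagPow i A, fun _ _ _ => rfl⟩
  map_add' _ _ := rfl
  map_smul' _ _ := rfl

theorem ProjHomFin.norm_diag_le (k : ℕ) (A : B →L[ℝ] B') : ‖ProjHomFin.diag k A‖ ≤ ‖A‖ := by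
  refine (pi_norm_le_iff_of_nonneg (norm_nonneg A)).2 fun i => ?_
  refine ContinuousLinearMap.opNorm_le_bound _ (norm_nonneg A) fun v => ?_
  refine (pi_norm_le_iff_of_nonneg (by positivity)).2 fun l => ?_
  exact (A.le_opNorm (v l)).trans (by gcongr; exact norm_le_pi_norm v l)

/-- A ↦ (A × ⋯ × A)_{i ≤ k} is linear and norm non-increasing for the sup norms, hence smooth. -/
theorem genSmoothOn_diag {A : Type*} [NormedAddCommGroup A] [NormedSpace ℝ A]
    {f : A → B →L[ℝ] B'} {s : Set A} (hf : ContDiffOn ℝ ∞ f s) :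
    GenSmoothOn (fun x => ProjHom.diag (f x)) s := by
  intro k
  have hD : IsBoundedLinearMap ℝ (ProjHomFin.diag (B := B) (B' := B') k) :=
    ⟨(ProjHomFin.diag k).isLinear, 1, one_pos, fun A =>
      (ProjHomFin.norm_diag_le k A).trans_eq (one_mul _).symm⟩
  have hc : ContDiff ℝ ∞ (ProjHomFin.diag (B := B) (B' := B') k) := hD.contDiff
  exact hc.comp_contDiffOn hf

end DiagonalHom

/-! ### The bundle structure and the morphism T^∞g. -/

section Bundles

variable {E M : Type*} [NormedAddCommGroup E] [NormedSpace ℝ E]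
  [TopologicalSpace M] [ChartedSpace E M] [IsManifold 𝓘(ℝ, E) ∞ M]
  {E' N : Type*} [NormedAddCommGroup E'] [NormedSpace ℝ E']
  [TopologicalSpace N] [ChartedSpace E' N] [IsManifold 𝓘(ℝ, E') ∞ N]

theorem TInf.isGenVBMorphism_map {KM : LinearConnection E M} {KN : LinearConnection E' N}
    {g : M → N} (hg : ContMDiff 𝓘(ℝ, E) 𝓘(ℝ, E') ∞ g) (hrel : KM.Related KN g) :
    IsGenVBMorphism (TInf.bundle KM) (TInf.bundle KN) (TInf.map hg) g where
  smooth_base := hg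
  continuous_total := TInf.continuous_map hg
  proj_comp := TInf.proj_map hg
  local_form e e' := by
    -- In z-coordinates every component transforms by the same operator, the first derivative of the
    -- local representative.
    refine ⟨fun x => ProjHom.diag (fderiv ℝ (localRep e e' g) x), ?_, fun u he he' => ?_⟩
    · rw [image_eq_localDomain]
      exact genSmoothOn_diag ((contDiffOn_localRep hg e e').fderiv_of_isOpen
        (isOpen_localDomain e e' hg.continuous) (by simp))
    · refine Subtype.ext (funext fun k => funext fun i => ?_)
      refine (TInf.trivFiber_apply KN e' (TInf.map hg u) k i).trans ?_
      rw [TInf.zCoord_coord_map hg hrel he he' i]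
      exact congrArg _ (TInf.trivFiber_apply KM e u k i).symm

theorem TInf.isGenVectorBundle (K : LinearConnection E M) :
    (TInf.bundle K).IsGenVectorBundle where
  fst_triv _ _ _ := rfl
  isHomeo e := ⟨TInf.trivHomeo K e, rfl, rfl, fun _ _ => rfl⟩
  transition e e' := by
    -- A change of trivialization is the local form of the identity morphism, since `K` is related
    -- to itself by the identity.
    obtain ⟨h, hs, hh⟩ := (TInf.isGenVBMorphism_map contMDiff_id K.related_id).local_form e e'
    refine ⟨h, hs, fun u he he' => ?_⟩
    rw [← hh u he he', TInf.map_id]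

end Bundles

end

theorem mainTheorem4
    {E E' M N : Type*}
    [NormedAddCommGroup E] [NormedSpace ℝ E] [CompleteSpace E]
    [NormedAddCommGroup E'] [NormedSpace ℝ E'] [CompleteSpace E']
    [TopologicalSpace M] [ChartedSpace E M] [IsManifold 𝓘(ℝ, E) ∞ M]
    [TopologicalSpace N] [ChartedSpace E' N] [IsManifold 𝓘(ℝ, E') ∞ N]
    (KM : LinearConnection E M) (KN : LinearConnection E' N)
    (g : M → N) (hg : ContMDiff 𝓘(ℝ, E) 𝓘(ℝ, E') ∞ g)
    (hrel : KM.Related KN g) :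
    (TInf.bundle KM).IsGenVectorBundle ∧
    (TInf.bundle KN).IsGenVectorBundle ∧
    IsGenVBMorphism (TInf.bundle KM) (TInf.bundle KN) (TInf.map hg) g ∧
    ((∃ f : Diffeomorph 𝓘(ℝ, E) 𝓘(ℝ, E') M N ∞, ⇑f = g) →
      IsGenVBIsomorphism (TInf.bundle KM) (TInf.bundle KN) (TInf.map hg) g) := by
  refine ⟨TInf.isGenVectorBundle KM, TInf.isGenVectorBundle KN, TInf.isGenVBMorphism_map hg hrel,
    ?_⟩
  rintro ⟨f, rfl⟩
  exact ⟨TInf.isGenVBMorphism_map hg hrel, TInf.map f.symm.contMDiff, f.symm,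
    TInf.isGenVBMorphism_map f.symm.contMDiff hrel.symm,
    TInf.map_comp_eq_id hg f.symm.contMDiff f.symm_apply_apply,
    TInf.map_comp_eq_id f.symm.contMDiff hg f.apply_symm_apply,
    f.symm_apply_apply, f.apply_symm_apply⟩
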